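/- For a finite group $G$ let $Z_\infty(G)$ denote its hypercenter (the last term of the upper central series). Put $[x,y]=x^{-1}y^{-1}xy$, $[x,{}_0y]=x$ and $[x,{}_{n+1}y]=[[x,{}_ny],y]$. The Engel graph $\Gamma(G)$ is the directed graph whose vertices are the elements of $G\setminus Z_\infty(G)$, with an edge $x\mapsto y$ if and only if $[x,{}_ny]=1$ for some $n>0$. Its diameter $\operatorname{diam}\Gamma(G)\in\mathbb N\cup\{\infty\}$ is the supremum of the directed distances $d(x,y)$ over all ordered pairs of vertices (it is $0$ if there are no vertices). A group $X$ is a Frobenius group if it has a subgroup $1\neq H\neq X$ with $H\cap gHg^{-1}=1$ for all $g\in X\setminus H$. (1) Let $G$ be a finite soluble group such that $G/Z_\infty(G)$ is not a Frobenius group. Then $\Gamma(G)$ is strongly connected and $\operatorname{diam}\Gamma(G)\le 4$. (2) There exists a finite soluble group $G$, with $G/Z_\infty(G)$ not a Frobenius group, such that $\operatorname{diam}\Gamma(G)=4$. (3) Explicitly: let $q$ be a power of an odd prime, let $r\ge 3$ be a prime with $r\mid q-1$ and $r^2\nmid q-1$, and let $t$ be a prime that divides $(q^r-1)/(q-1)$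 but not $q-1$. Let $\mathbb F$ be the field with $q^r$ elements, $F=\mathbb F^2$ its plane, and $\beta$ the map $a\mapsto a^q$ applied to both coordinates of $F$. Then $\mathbb F^\times$ has elements of order $r^2$ and of order $t$, and for all $e,f\in\mathbb F^\times$ of orders $r^2$ and $t$ respectively, with $z=\operatorname{diag}(e,e)$ and $c=\operatorname{diag}(1,f)$ in $\operatorname{GL}(2,\mathbb F)$, the subgroup $$G=F\rtimes\langle z\beta, c\rangle$$ of $\operatorname{A\Gamma L}(2,q^r)$ is finite and soluble, $G/Z_\infty(G)$ is not a Frobenius group, and $\operatorname{diam}\Gamma(G)=4$. In particular, for $q=7$, $r=3$, $t=19$ there are such $e$ and $f$, of orders $9$ and $19$, and the resulting group $G$ has these properties. -/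

import Mathlib

open scoped Matrix

/-! ## Directed graphs: distance, diameter, strong connectivity -/

namespace Engel

/-- `HasWalk Γ n x y`: there is a directed walk with exactly `n` edges from `x` to `y`. -/
def HasWalk {V : Type*} (Γ : Digraph V) : ℕ → V → V → Prop
  | 0, x, y => x = y
  | n + 1, x, y => ∃ z, Γ.Adj x z ∧ HasWalk Γ n z y

/-- Every vertex can be reached from every vertex along a directed path. -/
def StronglyConnected {V : Type*} (Γ : Digraph V) : Prop :=
  ∀ x y : V, ∃ n : ℕ, HasWalk Γ n x y

/-- The directed distance from `x` to `y`, equal to `⊤` if `y` cannot be reached from `x`. -/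
noncomputable def dist {V : Type*} (Γ : Digraph V) (x y : V) : ℕ∞ :=
  ⨅ (n : ℕ) (_ : HasWalk Γ n x y), (n : ℕ∞)

/-- The (directed) diameter: the supremum of all directed distances. -/
noncomputable def diam {V : Type*} (Γ : Digraph V) : ℕ∞ :=
  ⨆ (x : V) (y : V), dist Γ x y

/-! ## The Engel graph of a group -/

/-- The Engel word `[x, ₙ y]`, where `[a, b] = a⁻¹ b⁻¹ a b`. -/
def engelWord {G : Type*} [Group G] (x y : G) : ℕ → G
  | 0 => x
  | n + 1 => (engelWord x y n)⁻¹ * y⁻¹ * engelWord x y n * y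

/-- The hypercenter: the union of the upper central series (for a finite group, its last term). -/
def hypercenter (G : Type*) [Group G] : Subgroup G :=
  ⨆ n : ℕ, Subgroup.upperCentralSeries G n

instance hypercenter_normal (G : Type*) [Group G] : (hypercenter G).Normal :=
  Subgroup.iSup_normal _

/-- The Engel graph `Γ(G)`: its vertices are the non-hypercentral elements of `G`, and there is
an edge from `x` to `y` if `[x, ₙ y] = 1` for some `n > 0`. -/
def engelGraph (G : Type*) [Group G] : Digraph {g : G // g ∉ hypercenter G} where
  Adj x y := ∃ n : ℕ, 0 < n ∧ engelWord (x : G) (y : G) n = 1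

/-- A Frobenius group: there is a proper nontrivial subgroup `H` (a Frobenius complement) such
that `H ∩ g H g⁻¹ = 1` for every `g ∉ H`. -/
def IsFrobenius (G : Type*) [Group G] : Prop :=
  ∃ H : Subgroup G, H ≠ ⊥ ∧ H ≠ ⊤ ∧
    ∀ g : G, g ∉ H → H ⊓ H.map (MulAut.conj g).toMonoidHom = ⊥

/-! ## The groups `F ⋊ ⟨zβ, c⟩` inside the affine semilinear group of the plane `L²` -/

section Example

/-- The additive group `F` of the plane `L²`, written multiplicatively. -/
abbrev Plane (L : Type*) : Type _ := Multiplicative (Fin 2 → L)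

/-- The automorphism `v ↦ A v` of the plane given by a matrix `A ∈ GL(2, L)`. -/
def glAut {L : Type*} [Field L] (A : GL (Fin 2) L) : MulAut (Plane L) :=
  AddEquiv.toMultiplicative
    { toFun := fun v => (A : Matrix (Fin 2) (Fin 2) L) *ᵥ v
      invFun := fun v => ((A⁻¹ : GL (Fin 2) L) : Matrix (Fin 2) (Fin 2) L) *ᵥ v
      left_inv := fun v => by
        beta_reduce
        rw [Matrix.mulVec_mulVec, ← Matrix.GeneralLinearGroup.coe_mul, inv_mul_cancel,
          Matrix.GeneralLinearGroup.coe_one, Matrix.one_mulVec]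
      right_inv := fun v => by
        beta_reduce
        rw [Matrix.mulVec_mulVec, ← Matrix.GeneralLinearGroup.coe_mul, mul_inv_cancel,
          Matrix.GeneralLinearGroup.coe_one, Matrix.one_mulVec]
      map_add' := fun v w => Matrix.mulVec_add _ v w }

/-- The automorphism of the plane that applies a field automorphism to both coordinates. -/
def fieldAut {L : Type*} [Field L] (b : L ≃+* L) : MulAut (Plane L) :=
  AddEquiv.toMultiplicative
    { toFun := fun v i => b (v i)
      invFun := fun v i => b.symm (v i)
      left_inv := fun v => by funext i; simp
      right_inv := fun v => by funext i; simp
      map_add' := fun v w => by funext i; simp }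

/-- The Frobenius automorphism `β : a ↦ a ^ q` of `L` over the subfield `K` with `q` elements. -/
noncomputable def frobAut (K L : Type*) [Field K] [Fintype K] [Field L] [Algebra K L]
    [FiniteDimensional K L] : L ≃+* L :=
  (FiniteField.frobeniusAlgEquivOfAlgebraic K L).toRingEquiv

/-- The diagonal matrix with entries `a`, `b`. -/
noncomputable def diagGL {L : Type*} [Field L] (a b : Lˣ) : GL (Fin 2) L :=
  Matrix.GeneralLinearGroup.mkOfDetNeZero !![(a : L), 0; 0, (b : L)] (by
    simp [Matrix.det_fin_two_of])

/-- The group `D = ⟨zβ, c⟩` of semilinear maps, with `z = diag(e, e)` and `c = diag(1, f)`. -/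
noncomputable def exampleD (K L : Type*) [Field K] [Fintype K] [Field L] [Algebra K L]
    [FiniteDimensional K L] (e f : Lˣ) : Subgroup (MulAut (Plane L)) :=
  Subgroup.closure {glAut (diagGL e e) * fieldAut (frobAut K L), glAut (diagGL 1 f)}

/-- The group `G = F ⋊ D`, with the natural action of `D` on the plane. -/
abbrev ExampleGroup (K L : Type*) [Field K] [Fintype K] [Field L] [Algebra K L]
    [FiniteDimensional K L] (e f : Lˣ) : Type _ :=
  SemidirectProduct (Plane L) (exampleD K L e f) (exampleD K L e f).subtype

end Example

instance fact_prime_seven : Fact (Nat.Prime 7) := ⟨by norm_num⟩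

end Engel

/-!
**The upper bound.** Engel words can be tested modulo the hypercenter, so it is enough to treat a
finite soluble group `G` with trivial center that is not a Frobenius group. Let `F` be its Fitting
subgroup. As `F` is normal and nilpotent, every `x` has an edge to every `f ∈ F`. Hence a walk
`x ↦ f ↦ v ↦ w ↦ y` exists as soon as some `v ≠ 1` with `v ↦ w ↦ y` commutes with some `1 ≠ f ∈ F`.
If there is none, then all elements at distance at most two from `y` act on `F` by conjugation
without fixed points, and it has to be shown that all elements outside of `F` do
(`fixedPointFree_of_forall_engelRel`): then `F` has a complement by the Schur-Zassenhaus theorem, and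
`G` is a Frobenius group (`isFrobenius_of_fixedPointFree`).

This is proved in `H = G / F`; let `X` be the set of its elements that act on `F` without fixed
points. Since `y` is fixed-point-free, all elements that commute with the image of `y` lift to
elements that commute with `y`. Therefore `X` contains all non-trivial elements that normalise some
`⟨a⟩`, where `a ≠ 1` commutes with `y`. Averaging arguments on abelian groups exclude two kinds of
subgroups of `H`: elementary abelian groups of rank two in `X ∪ {1}`
(`nsmul_eq_zero_of_fixedPointFree`), and Frobenius groups `R ⋊ ⟨b⟩` with `b ∈ X` of prime order and
`R` a subgroup of a core `O_q(H)` (`card_nsmul_eq_sum_of_fixedPointFree`,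
`FixedPointFree.commute_of_coprime`). These three facts form the structure `FixedPointFreeConfig`.
Assume that `X` misses some non-trivial element. If `O_q(H) ≠ 1`, then `q` does not divide the order
of `y`, and some prime divisor `p` of `q - 1` does. An element of order `p` of `⟨y⟩` centralises
`O_q(H)`, because a minimal subgroup of `O_q(H)` on which it acts non-trivially would be cyclic
(`isCyclic_of_minimal_action`). Consequently `O_q(H)` is contained in `X ∪ {1}` and is itself cyclic
(`isCyclic_of_forall_mem_zpowers`), and all elements of prime order of `⟨y⟩` centralise it. So they
centralise the Fitting subgroup of the soluble group `H`, and lie in it: a contradiction.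

**The examples.** In `G = F ⋊ ⟨zβ, c⟩` put `w = zβ`. Its power `wʳ` is the scalar `ε = e ^ N` with
`N = 1 + q + ⋯ + q ^ (r - 1)`, and `N ≡ r` modulo `r²`, so `ε` has order `r`. Each element of
`⟨w, c⟩` acts on `F` without fixed points, or is a power of `c = diag(1, f)`. A non-trivial element
of `⟨w, c⟩` without fixed points, such as `w`, has all its predecessors in `⟨w, c⟩`. The
predecessors of `w` are not powers of `c`, as `w` acts on `⟨c⟩` without fixed points; so they have
no fixed points on `F` either, and their predecessors are again in `⟨w, c⟩`. A predecessor of an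
element `cⁱ ≠ 1` has its component in `F` on the first coordinate axis. So `(0, 1) ∈ F` has distance
at least four from `w`. Finally `G` has trivial center, and it is not a Frobenius group since `c`, the
central element `wʳ` of `⟨w, c⟩` and `F` are connected by chains of commuting elements.
-/

namespace Engel

/-! ### Engel words and the hypercenter -/

section EngelWord

variable {G H : Type*} [Group G] [Group H]

/-- The Engel relation `x ↦ y`: some Engel word `[x, ₙ y]` is trivial. -/
def EngelRel (x y : G) : Prop := ∃ n : ℕ, engelWord x y n = 1

theorem map_engelWord (φ : G →* H) (x y : G) (n : ℕ) :
    φ (engelWord x y n) = engelWord (φ x) (φ y) n := by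
  induction n with
  | zero => rfl
  | succ n ih => simp [engelWord, ih]

theorem engelWord_add (x y : G) (m n : ℕ) :
    engelWord x y (m + n) = engelWord (engelWord x y m) y n := by
  induction n with
  | zero => rfl
  | succ n ih => rw [← add_assoc]; simp [engelWord, ih]

theorem engelWord_succ' (x y : G) (n : ℕ) :
    engelWord x y (n + 1) = engelWord (x⁻¹ * y⁻¹ * x * y) y n := by
  rw [add_comm, engelWord_add]; rfl

theorem engelRel_iff_pos (x y : G) :
    EngelRel x y ↔ ∃ n : ℕ, 0 < n ∧ engelWord x y n = 1 := by
  constructor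
  · rintro ⟨n, hn⟩
    refine ⟨n + 1, n.succ_pos, ?_⟩
    simp [engelWord, hn]
  · rintro ⟨n, -, hn⟩
    exact ⟨n, hn⟩

theorem EngelRel.of_commute {x y : G} (h : Commute x y) : EngelRel x y := by
  refine ⟨1, ?_⟩
  have : x * y = y * x := h
  simp only [engelWord]
  rw [mul_assoc, this]
  group

/-- If `x` normalises `⟨y⟩`, then `[x, ₂ y] = 1`. -/
theorem EngelRel.of_conj_mem_zpowers {x y : G} (h : x⁻¹ * y * x ∈ Subgroup.zpowers y) :
    EngelRel x y := by
  obtain ⟨k, hk⟩ := h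
  have hk : y ^ k = x⁻¹ * y * x := hk
  have h1 : x⁻¹ * y⁻¹ * x * y = y ^ (-k) * y := by
    rw [zpow_neg, hk]; group
  refine ⟨2, ?_⟩
  rw [engelWord_succ', h1]
  simp only [engelWord]
  group

theorem engelWord_eq_one_of_mem_upperCentralSeries (y : G) (k : ℕ) :
    ∀ x ∈ Subgroup.upperCentralSeries G k, engelWord x y k = 1 := by
  induction k with
  | zero => intro x hx; exact Subgroup.mem_bot.1 hx
  | succ k ih =>
    intro x hx
    rw [engelWord_succ']
    apply ih
    have h := Subgroup.mem_upperCentralSeries_succ_iff.1 (inv_mem hx) y⁻¹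
    simpa [commutatorElement_def] using h

theorem exists_mem_upperCentralSeries {x : G} (hx : x ∈ hypercenter G) :
    ∃ k, x ∈ Subgroup.upperCentralSeries G k := by
  have hd : Directed (· ≤ ·) (Subgroup.upperCentralSeries G) :=
    (Subgroup.upperCentralSeries_mono G).directed_le
  exact (Subgroup.mem_iSup_of_directed hd).1 hx

/-- The Engel relation can be tested modulo the hypercenter. -/
theorem EngelRel.of_quotient_hypercenter {x y : G}
    (h : EngelRel (x : G ⧸ hypercenter G) (y : G ⧸ hypercenter G)) : EngelRel x y := by
  obtain ⟨n, hn⟩ := h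
  have h1 : engelWord x y n ∈ hypercenter G := by
    rw [← QuotientGroup.eq_one_iff]
    exact (map_engelWord (QuotientGroup.mk' (hypercenter G)) x y n).trans hn
  obtain ⟨k, hk⟩ := exists_mem_upperCentralSeries h1
  exact ⟨n + k, by rw [engelWord_add]; exact engelWord_eq_one_of_mem_upperCentralSeries y k _ hk⟩

theorem exists_hypercenter_eq_upperCentralSeries [Finite G] :
    ∃ n, hypercenter G = Subgroup.upperCentralSeries G n := by
  obtain ⟨n, hn⟩ := WellFoundedGT.monotone_chain_condition
    ⟨Subgroup.upperCentralSeries G, Subgroup.upperCentralSeries_mono G⟩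
  refine ⟨n, le_antisymm (iSup_le fun m => ?_) (le_iSup _ n)⟩
  rcases le_total m n with h | h
  · exact Subgroup.upperCentralSeries_mono G h
  · exact (hn m h).ge

theorem center_quotient_hypercenter [Finite G] :
    Subgroup.center (G ⧸ hypercenter G) = ⊥ := by
  obtain ⟨n, hn⟩ := exists_hypercenter_eq_upperCentralSeries (G := G)
  rw [eq_bot_iff]
  intro x hx
  induction x using QuotientGroup.induction_on with
  | H x =>
    rw [Subgroup.mem_bot, QuotientGroup.eq_one_iff]
    have h2 : x ∈ Subgroup.upperCentralSeries G (n + 1) := by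
      rw [Subgroup.mem_upperCentralSeries_succ_iff]
      intro y
      rw [← hn, ← QuotientGroup.eq_one_iff, commutatorElement_def]
      have h3 := Subgroup.mem_center_iff.1 hx (y : G ⧸ hypercenter G)
      rw [QuotientGroup.mk_mul, QuotientGroup.mk_mul, QuotientGroup.mk_mul, ← h3,
        QuotientGroup.mk_inv, QuotientGroup.mk_inv]
      group
    exact (le_iSup (Subgroup.upperCentralSeries G) (n + 1)) h2

theorem hypercenter_eq_bot_of_center_eq_bot (h : Subgroup.center G = ⊥) : hypercenter G = ⊥ := by
  have h1 : ∀ n, Subgroup.upperCentralSeries G n = ⊥ := by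
    intro n
    induction n with
    | zero => rfl
    | succ n ih =>
      rw [eq_bot_iff]
      intro x hx
      rw [← h, Subgroup.mem_center_iff]
      intro y
      have h2 := Subgroup.mem_upperCentralSeries_succ_iff.1 hx y
      rw [ih, Subgroup.mem_bot, commutatorElement_eq_one_iff_mul_comm] at h2
      exact h2.symm
  exact le_bot_iff.1 (iSup_le fun n => (h1 n).le)

end EngelWord

/-! ### The Fitting subgroup of a finite soluble group -/

section Fitting

variable {G : Type*} [Group G]

/-- The `p`-core `O_p(G)`: the join of all normal `p`-subgroups. -/
def pCore (p : ℕ) (G : Type*) [Group G] : Subgroup G :=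
  sSup {N : Subgroup G | N.Normal ∧ IsPGroup p N}

theorem le_pCore {p : ℕ} {N : Subgroup G} (hN : N.Normal) (hp : IsPGroup p N) : N ≤ pCore p G :=
  le_sSup ⟨hN, hp⟩

instance pCore_normal (p : ℕ) : (pCore p G).Normal :=
  Subgroup.sSup_normal _ fun _ h => h.1

theorem pCore_isPGroup (p : ℕ) : IsPGroup p (pCore p G) :=
  Sylow.sSup_of_normal _ (fun _ h => h.2) (fun _ h => h.1)

theorem exists_pow_eq_one_of_mem {p : ℕ} {Q : Subgroup G} (hQ : IsPGroup p Q) {x : G} (hx : x ∈ Q) :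
    ∃ k : ℕ, x ^ p ^ k = 1 := by
  obtain ⟨k, hk⟩ := hQ ⟨x, hx⟩
  exact ⟨k, by simpa [Subtype.ext_iff] using hk⟩

/-- The Fitting subgroup of a finite group, as the join of its `p`-cores. -/
def fitting (G : Type*) [Group G] : Subgroup G :=
  ⨆ p : (Nat.card G).primeFactors, pCore (p : ℕ) G

instance fitting_normal : (fitting G).Normal :=
  Subgroup.iSup_normal _

/-- A subgroup that contains all powers of `g` of prime power order contains `g`. -/
theorem mem_of_primary_powers_mem (K : Subgroup G) {g : G} (hg : IsOfFinOrder g)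
    (h : ∀ p : ℕ, p.Prime → ∀ n k : ℕ, (g ^ n) ^ p ^ k = 1 → g ^ n ∈ K) : g ∈ K := by
  have key : ∀ m : ℕ, 0 < m → ∀ n, (g ^ n) ^ m = 1 → g ^ n ∈ K := by
    intro m
    induction m using Nat.recOnPosPrimePosCoprime with
    | prime_pow p k hp hk => intro _ n hn; exact h p hp n k hn
    | zero => intro h; exact absurd h (lt_irrefl _)
    | one => intro _ n hn; rw [pow_one] at hn; rw [hn]; exact K.one_mem
    | coprime a b ha hb hab iha ihb =>
      intro _ n hn
      have h1 : g ^ (n * a) ∈ K := ihb (by omega) _ (by rw [← pow_mul, mul_assoc, pow_mul]; exact hn)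
      have h2 : g ^ (n * b) ∈ K := iha (by omega) _ (by
        rw [← pow_mul, mul_assoc, mul_comm b a, pow_mul]; exact hn)
      have h3 : (n : ℤ) = (n * a : ℕ) * Nat.gcdA a b + (n * b : ℕ) * Nat.gcdB a b := by
        have := Nat.gcd_eq_gcd_ab a b
        rw [hab] at this
        push_cast at this ⊢
        linear_combination (n : ℤ) * this
      have h4 : g ^ n = (g ^ (n * a)) ^ Nat.gcdA a b * (g ^ (n * b)) ^ Nat.gcdB a b := by
        rw [← zpow_natCast g n, h3, zpow_add, zpow_mul, zpow_mul, zpow_natCast, zpow_natCast]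
      rw [h4]
      exact K.mul_mem (K.zpow_mem h1 _) (K.zpow_mem h2 _)
  have := key (orderOf g) hg.orderOf_pos 1 (by rw [pow_one, pow_orderOf_eq_one])
  rwa [pow_one] at this

theorem isPGroup_zpowers_of_pow_eq_one {p k : ℕ} {x : G} (hx : x ^ p ^ k = 1) :
    IsPGroup p (Subgroup.zpowers x) := by
  apply IsPGroup.of_card_dvd_pow (n := k)
  rw [Nat.card_zpowers]
  exact orderOf_dvd_of_pow_eq_one hx

variable [Finite G]

/-- The Sylow subgroups of a normal nilpotent subgroup are normal in the whole group. -/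
theorem mem_pCore_of_mem_nilpotent {K : Subgroup G} (hK : K.Normal) (hn : Group.IsNilpotent K)
    {p k : ℕ} (hp : p.Prime) {x : G} (hx : x ∈ K) (hxp : x ^ p ^ k = 1) : x ∈ pCore p G := by
  have := Fact.mk hp
  have hxp' : (⟨x, hx⟩ : K) ^ p ^ k = 1 := Subtype.ext (by simpa using hxp)
  obtain ⟨P, hP⟩ := (isPGroup_zpowers_of_pow_eq_one hxp').exists_le_sylow
  have hPn : (P : Subgroup K).Normal :=
    P.normal_of_normalizerCondition (Group.normalizerCondition_of_isNilpotent (G := K))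
  have : (P : Subgroup K).Characteristic := P.characteristic_of_normal hPn
  have h1 : ((P : Subgroup K).map K.subtype).Normal := inferInstance
  have h2 : IsPGroup p ((P : Subgroup K).map K.subtype) := P.isPGroup'.map _
  exact le_pCore h1 h2 ⟨⟨x, hx⟩, hP (Subgroup.mem_zpowers _), rfl⟩

theorem pCore_le_fitting {p : ℕ} (hp : p.Prime) : pCore p G ≤ fitting G := by
  by_cases h : p ∣ Nat.card G
  · exact le_iSup (fun p : (Nat.card G).primeFactors => pCore (p : ℕ) G)
      ⟨p, Nat.mem_primeFactors.2 ⟨hp, h, Nat.card_pos.ne'⟩⟩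
  · have := Fact.mk hp
    rcases (pCore_isPGroup (G := G) p).card_eq_or_dvd with h1 | h1
    · rw [Subgroup.card_eq_one.1 h1]; exact bot_le
    · exact absurd (h1.trans (Subgroup.card_subgroup_dvd_card _)) h

theorem le_fitting {K : Subgroup G} (hK : K.Normal) (hn : Group.IsNilpotent K) :
    K ≤ fitting G := by
  intro x hx
  refine mem_of_primary_powers_mem _ (isOfFinOrder_of_finite x) fun p hp n k h => ?_
  exact pCore_le_fitting hp (mem_pCore_of_mem_nilpotent hK hn hp (K.pow_mem hx n) h)

theorem fitting_nilpotent : Group.IsNilpotent (fitting G) := by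
  classical
  let S : (Nat.card G).primeFactors → Subgroup G := fun p => pCore (p : ℕ) G
  have hprime : ∀ i : (Nat.card G).primeFactors, Fact (i : ℕ).Prime :=
    fun i => ⟨Nat.prime_of_mem_primeFactors i.2⟩
  have hc : Pairwise fun i j => ∀ x y : G, x ∈ S i → y ∈ S j → Commute x y := by
    intro i j hij x y hx hy
    have := hprime i
    have := hprime j
    exact Subgroup.commute_of_normal_of_disjoint _ _ (pCore_normal _) (pCore_normal _)
      (IsPGroup.disjoint_of_ne _ _ (fun h => hij (Subtype.ext h)) _ _
        (pCore_isPGroup _) (pCore_isPGroup _)) x y hx hy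
  have : ∀ i, Group.IsNilpotent (S i) := fun i => by
    have := hprime i
    exact (pCore_isPGroup (G := G) (i : ℕ)).isNilpotent
  have h1 : (Subgroup.noncommPiCoprod hc).range = fitting G := Subgroup.noncommPiCoprod_range
  have h2 : Group.IsNilpotent (Subgroup.noncommPiCoprod hc).range :=
    Group.nilpotent_of_surjective _ (Subgroup.noncommPiCoprod hc).rangeRestrict_surjective
  rwa [h1] at h2

theorem mem_pCore_of_mem_fitting {p k : ℕ} (hp : p.Prime) {x : G} (hx : x ∈ fitting G)
    (hxp : x ^ p ^ k = 1) : x ∈ pCore p G :=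
  mem_pCore_of_mem_nilpotent fitting_normal fitting_nilpotent hp hx hxp

/-- In a finite soluble group the Fitting subgroup contains its centraliser. -/
theorem centralizer_fitting_le [Group.IsSolvable G] :
    Subgroup.centralizer (fitting G : Set G) ≤ fitting G := by
  set C := Subgroup.centralizer (fitting G : Set G) with hC
  by_contra hle
  -- the derived series of `C`, as normal subgroups of `G`
  let D : ℕ → Subgroup G := fun n => (derivedSeries C n).map C.subtype
  have hD0 : D 0 = C := by simp [D, ← MonoidHom.range_eq_map]
  have hDs : ∀ n, ⁅D n, D n⁆ = D (n + 1) := fun n => by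
    simp only [D, derivedSeries_succ, Subgroup.map_commutator]
  have hCn : C.Normal := inferInstance
  have hDn : ∀ n, (D n).Normal := fun n => by
    simp only [D]; infer_instance
  have hDC : ∀ n, D n ≤ C := fun n => Subgroup.map_subtype_le _
  obtain ⟨m, hm⟩ := (Group.isSolvable_def C).1 inferInstance
  have hex : ∃ n, D n ≤ fitting G := ⟨m, by simp [D, hm]⟩
  classical
  have h0 : Nat.find hex ≠ 0 := by
    intro h
    have := Nat.find_spec hex
    rw [h, hD0] at this
    exact hle this
  obtain ⟨n, hn⟩ := Nat.exists_eq_succ_of_ne_zero h0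
  have h1 : ¬ D n ≤ fitting G := Nat.find_min hex (by omega)
  have h2 : D (n + 1) ≤ fitting G := by
    have := Nat.find_spec hex
    rwa [hn] at this
  -- `D n` is nilpotent of class at most two
  refine h1 (le_fitting (hDn n) ?_)
  apply Subgroup.isNilpotent_of_lowerCentralSeries_eq_bot (n := 2)
  rw [Subgroup.lowerCentralSeries_succ, Subgroup.lowerCentralSeries_succ,
    Subgroup.lowerCentralSeries_zero, hDs, Subgroup.commutator_eq_bot_iff_le_centralizer]
  exact h2.trans ((Subgroup.le_centralizer_iff).1 (hDC n))

theorem fitting_ne_bot [Group.IsSolvable G] [Nontrivial G] : fitting G ≠ ⊥ := by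
  intro h
  have h1 := centralizer_fitting_le (G := G)
  rw [h, le_bot_iff] at h1
  have h2 : Subgroup.centralizer ((⊥ : Subgroup G) : Set G) = ⊤ := by
    rw [eq_top_iff, ← Subgroup.le_centralizer_iff]
    exact bot_le
  exact bot_ne_top (h1.symm.trans h2)

/-- In a finite soluble group an element of prime order `p` that centralises all `q`-cores lies in
the `p`-core. -/
theorem mem_pCore_of_centralizes [Group.IsSolvable G] {p : ℕ} (hp : p.Prime) {b : G}
    (hb : b ^ p = 1) (h : ∀ q : ℕ, q.Prime → ∀ x ∈ pCore q G, x * b = b * x) : b ∈ pCore p G := by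
  have h1 : b ∈ Subgroup.centralizer (fitting G : Set G) := by
    have : fitting G ≤ Subgroup.centralizer {b} := by
      refine iSup_le fun q => fun x hx => ?_
      rw [Subgroup.mem_centralizer_singleton_iff]
      exact h q (Nat.prime_of_mem_primeFactors q.2) x hx
    intro x hx
    exact Subgroup.mem_centralizer_singleton_iff.1 (this hx)
  exact mem_pCore_of_mem_fitting (k := 1) hp (centralizer_fitting_le h1) (by simpa using hb)

end Fitting

/-! ### Fixed-point-free elements and norms -/

section FixedPointFree

variable {K : Type*} [Group K]

/-- `b` acts by conjugation without non-trivial fixed points on the subgroup `N`. -/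
def FixedPointFree (N : Subgroup K) (b : K) : Prop :=
  ∀ n ∈ N, n * b = b * n → n = 1

theorem FixedPointFree.mono {N M : Subgroup K} {b : K} (h : FixedPointFree N b) (hM : M ≤ N) :
    FixedPointFree M b :=
  fun n hn => h n (hM hn)

theorem FixedPointFree.pow {N : Subgroup K} {b : K} {p i : ℕ} (h : FixedPointFree N b)
    (hp : p.Prime) (hb : b ^ p = 1) (hi : ¬ p ∣ i) : FixedPointFree N (b ^ i) := by
  intro n hn hc
  have h1 : Commute n (b ^ (i.gcd p)) := by
    rw [← zpow_natCast, Nat.gcd_eq_gcd_ab, zpow_add, zpow_mul, zpow_mul, zpow_natCast,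
      zpow_natCast, hb, one_zpow, mul_one]
    exact (show Commute n (b ^ i) from hc).zpow_right _
  rw [((Nat.Prime.coprime_iff_not_dvd hp).2 hi).symm.gcd_eq_one, pow_one] at h1
  exact h n hn h1

/-- If `b` acts fixed-point-freely on a finite normal subgroup `N`, then the coset `Nb` is a single
orbit under conjugation by `N`: the map `m ↦ [m, b]` is injective on `N`, hence onto. -/
theorem FixedPointFree.exists_conj {N : Subgroup K} [N.Normal] [Finite N] {b : K}
    (h : FixedPointFree N b) {n : K} (hn : n ∈ N) : ∃ m ∈ N, m * b * m⁻¹ = n * b := by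
  let φ : N → N := fun m => m * (MulAut.conjNormal b m⁻¹)
  have hφ : Function.Injective φ := by
    intro m k hmk
    have h1 : (m : K) * (b * (m : K)⁻¹ * b⁻¹) = k * (b * (k : K)⁻¹ * b⁻¹) := by
      simpa [φ, Subtype.ext_iff, MulAut.conjNormal_apply, mul_assoc] using hmk
    have h2 : (k : K)⁻¹ * m = 1 := by
      apply h _ (N.mul_mem (N.inv_mem k.2) m.2)
      have h3 : (m : K) * b * (m : K)⁻¹ = k * b * (k : K)⁻¹ := by
        rw [show (m : K) * b * (m : K)⁻¹ = m * (b * (m : K)⁻¹ * b⁻¹) * b by group, h1]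
        group
      calc (k : K)⁻¹ * m * b = (k : K)⁻¹ * (m * b * (m : K)⁻¹) * m := by group
        _ = b * ((k : K)⁻¹ * m) := by rw [h3]; group
    exact Subtype.ext (inv_mul_eq_one.1 h2).symm
  obtain ⟨m, hm⟩ := Finite.surjective_of_injective hφ ⟨n, hn⟩
  refine ⟨m, m.2, ?_⟩
  have h1 : (m : K) * (b * (m : K)⁻¹ * b⁻¹) = n := by
    simpa [φ, Subtype.ext_iff, MulAut.conjNormal_apply, mul_assoc] using hm
  rw [← h1]; group

theorem FixedPointFree.conj {N : Subgroup K} [N.Normal] {b : K} (h : FixedPointFree N b) (g : K) :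
    FixedPointFree N (g * b * g⁻¹) := by
  intro n hn hc
  have h1 := h (g⁻¹ * n * g) (by simpa using Subgroup.Normal.conj_mem ‹_› n hn g⁻¹) (by
    calc g⁻¹ * n * g * b = g⁻¹ * (n * (g * b * g⁻¹)) * g := by group
      _ = b * (g⁻¹ * n * g) := by rw [hc]; group)
  calc n = g * (g⁻¹ * n * g) * g⁻¹ := by group
    _ = 1 := by rw [h1]; group

/-- Acting fixed-point-freely on `N` only depends on the coset modulo `N`. -/
theorem FixedPointFree.mul_left {N : Subgroup K} [N.Normal] [Finite N] {b : K}
    (h : FixedPointFree N b) {n : K} (hn : n ∈ N) : FixedPointFree N (n * b) := by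
  obtain ⟨m, -, hm⟩ := h.exists_conj hn
  rw [← hm]
  exact h.conj m

/-- Fixed-point-free action passes to quotients. -/
theorem FixedPointFree.map_mk {N Z : Subgroup K} [Z.Normal] [Finite Z] (hZ : Z ≤ N) {b : K}
    (h : FixedPointFree N b) :
    FixedPointFree (N.map (QuotientGroup.mk' Z)) (QuotientGroup.mk' Z b) := by
  rintro _ ⟨n, hn, rfl⟩ hc
  have hz : n * b * n⁻¹ * b⁻¹ ∈ Z := by
    rw [← QuotientGroup.ker_mk' Z, MonoidHom.mem_ker]
    simp only [map_mul, map_inv, hc]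
    group
  obtain ⟨m, hm, hmb⟩ := (h.mono hZ).exists_conj hz
  have h1 : m * b * m⁻¹ = n * b * n⁻¹ := by rw [hmb]; group
  have h2 : m⁻¹ * n = 1 := by
    apply h _ (N.mul_mem (N.inv_mem (hZ hm)) hn)
    calc m⁻¹ * n * b = m⁻¹ * (n * b * n⁻¹) * n := by group
      _ = b * (m⁻¹ * n) := by rw [← h1]; group
  rw [← inv_mul_eq_one.1 h2, ← MonoidHom.mem_ker, QuotientGroup.ker_mk']
  exact hm

/-- A fixed-point-free element of prime order `p` only acts on groups of order prime to `p`. -/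
theorem FixedPointFree.not_dvd_card {N : Subgroup K} [N.Normal] [Finite N] {p k : ℕ} (hp : p.Prime)
    {b : K} (hb : b ^ p ^ k = 1) (h : FixedPointFree N b) : ¬ p ∣ Nat.card N := by
  have := Fact.mk hp
  let _ : MulAction (Subgroup.zpowers b) N :=
    MulAction.compHom N ((MulAut.conjNormal (H := N)).comp (Subgroup.zpowers b).subtype)
  have h1 := (isPGroup_zpowers_of_pow_eq_one hb).card_modEq_card_fixedPoints N
  have h2 : MulAction.fixedPoints (Subgroup.zpowers b) N = {1} := by
    ext n
    constructor
    · intro hn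
      have h3 := hn ⟨b, Subgroup.mem_zpowers b⟩
      have h4 : b * (n : K) * b⁻¹ = n := congrArg Subtype.val h3
      exact Subtype.ext (h n n.2 (mul_inv_eq_iff_eq_mul.1 h4).symm)
    · rintro rfl g
      exact map_one (MulAut.conjNormal (H := N) (g : K))
  rw [h2, Nat.card_eq_fintype_card (α := ({1} : Set N)), Fintype.card_unique] at h1
  intro hd
  have h3 := (Nat.modEq_zero_iff_dvd.2 hd).symm.trans h1
  exact hp.one_lt.ne' (Nat.dvd_one.1 (Nat.modEq_zero_iff_dvd.1 h3.symm))

end FixedPointFree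

section Norms

variable {V : Type*} [AddCommGroup V]

/-- The norm of an automorphism of finite order without fixed points vanishes. -/
theorem geom_sum_eq_zero_of_fixedPointFree {c : AddMonoid.End V} {p : ℕ} (hc : c ^ p = 1)
    (h : ∀ v, c v = v → v = 0) : ∑ i ∈ Finset.range p, c ^ i = 0 := by
  ext v
  apply h
  have h1 := mul_geom_sum c p
  rw [hc, sub_self, sub_mul, one_mul, sub_eq_zero] at h1
  exact congrArg (fun f : AddMonoid.End V => f v) h1

/-- Two commuting automorphisms `b`, `s` of prime order `p` such that all `bⁱ ≠ 1` and all `bʲs` are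
fixed-point-free: the norms of the `bʲs` add up to multiplication by `p`. -/
theorem nsmul_eq_zero_of_fixedPointFree {b s : AddMonoid.End V} {p : ℕ} (hp : p.Prime)
    (hbs : Commute b s) (hb : b ^ p = 1) (hs : s ^ p = 1)
    (h1 : ∀ i, ¬ p ∣ i → ∀ v, (b ^ i) v = v → v = 0)
    (h2 : ∀ j, ∀ v, (b ^ j * s) v = v → v = 0) (v : V) : p • v = 0 := by
  have h3 : ∑ j ∈ Finset.range p, ∑ i ∈ Finset.range p, (b ^ j * s) ^ i = 0 := by
    refine Finset.sum_eq_zero fun j _ => geom_sum_eq_zero_of_fixedPointFree ?_ (h2 j)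
    rw [(hbs.pow_left j).mul_pow, ← pow_mul, mul_comm, pow_mul, hb, one_pow, hs, one_mul]
  have h4 : ∀ i ∈ Finset.range p, ∑ j ∈ Finset.range p, (b ^ j * s) ^ i =
      if i = 0 then (p : AddMonoid.End V) else 0 := by
    intro i hi
    split_ifs with h0
    · simp [h0]
    · have h5 : ∑ j ∈ Finset.range p, (b ^ i) ^ j = 0 := by
        apply geom_sum_eq_zero_of_fixedPointFree
        · rw [← pow_mul, mul_comm, pow_mul, hb, one_pow]
        · exact h1 i (Nat.not_dvd_of_pos_of_lt (Nat.pos_of_ne_zero h0) (Finset.mem_range.1 hi))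
      calc ∑ j ∈ Finset.range p, (b ^ j * s) ^ i = ∑ j ∈ Finset.range p, (b ^ i) ^ j * s ^ i := by
            refine Finset.sum_congr rfl fun j _ => ?_
            rw [(hbs.pow_left j).mul_pow, ← pow_mul, ← pow_mul, mul_comm]
        _ = 0 := by rw [← Finset.sum_mul, h5, zero_mul]
  rw [Finset.sum_comm, Finset.sum_congr rfl h4, Finset.sum_ite_eq' (Finset.range p) 0,
    if_pos (Finset.mem_range.2 hp.pos)] at h3
  simpa using congrArg (fun f : AddMonoid.End V => f v) h3

/-- Let `R` be a finite group normalised by an element `b` of prime order with `C_R(b) = 1`. If `b`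
acts without fixed points on `V`, then summing the norms of all conjugates of `b` under `R` shows
that the norm of `R` is multiplication by `|R|`. -/
theorem card_nsmul_eq_sum_of_fixedPointFree {K : Type*} [Group K] (ρ : K →* AddMonoid.End V)
    (R : Subgroup K) [Fintype R] {b : K} {p : ℕ} (hp : p.Prime) (hb : b ^ p = 1)
    (hbR : ∀ r ∈ R, b * r * b⁻¹ ∈ R) (hR : FixedPointFree R b) (hV : ∀ v, ρ b v = v → v = 0)
    (v : V) : Fintype.card R • v = ∑ r : R, ρ r v := by
  have hNb : ∑ i ∈ Finset.range p, (ρ b) ^ i = 0 :=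
    geom_sum_eq_zero_of_fixedPointFree (by rw [← map_pow, hb, map_one]) hV
  have hbR' : ∀ i : ℕ, ∀ r ∈ R, b ^ i * r * (b ^ i)⁻¹ ∈ R := by
    intro i
    induction i with
    | zero => intro r hr; simpa using hr
    | succ i ih =>
      intro r hr
      have := hbR _ (ih r hr)
      rw [pow_succ']
      convert this using 1
      group
  have h1 : ∑ r : R, ∑ i ∈ Finset.range p, ρ ((r : K) * b ^ i * (r : K)⁻¹) = 0 := by
    refine Finset.sum_eq_zero fun r _ => ?_
    have : ∑ i ∈ Finset.range p, ρ ((r : K) * b ^ i * (r : K)⁻¹) =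
        ρ r * (∑ i ∈ Finset.range p, (ρ b) ^ i) * ρ (r : K)⁻¹ := by
      rw [Finset.mul_sum, Finset.sum_mul]
      exact Finset.sum_congr rfl fun i _ => by simp [map_mul, map_pow]
    rw [this, hNb, mul_zero, zero_mul]
  have h2 : ∀ i, ¬ p ∣ i →
      ∑ r : R, ρ ((r : K) * b ^ i * (r : K)⁻¹) = (∑ r : R, ρ r) * (ρ b) ^ i := by
    intro i hi
    let θ : R → R := fun r =>
      ⟨r * (b ^ i * (r : K)⁻¹ * (b ^ i)⁻¹), R.mul_mem r.2 (hbR' i _ (R.inv_mem r.2))⟩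
    have hθ : Function.Bijective θ := by
      rw [← Finite.injective_iff_bijective]
      intro r s hrs
      have h3 : (r : K) * (b ^ i * (r : K)⁻¹ * (b ^ i)⁻¹) =
        s * (b ^ i * (s : K)⁻¹ * (b ^ i)⁻¹) := congrArg Subtype.val hrs
      have h4 : (r : K) * b ^ i * (r : K)⁻¹ = s * b ^ i * (s : K)⁻¹ := by
        calc (r : K) * b ^ i * (r : K)⁻¹ = r * (b ^ i * (r : K)⁻¹ * (b ^ i)⁻¹) * b ^ i := by group
          _ = s * b ^ i * (s : K)⁻¹ := by rw [h3]; group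
      have h5 : (s : K)⁻¹ * r = 1 := by
        apply hR.pow hp hb hi _ (R.mul_mem (R.inv_mem s.2) r.2)
        calc (s : K)⁻¹ * r * b ^ i = (s : K)⁻¹ * (r * b ^ i * (r : K)⁻¹) * r := by group
          _ = b ^ i * ((s : K)⁻¹ * r) := by rw [h4]; group
      exact Subtype.ext (inv_mul_eq_one.1 h5).symm
    rw [← hθ.sum_comp (fun r : R => ρ r), Finset.sum_mul]
    refine Finset.sum_congr rfl fun r _ => ?_
    rw [← map_pow, ← map_mul]
    congr 1
    simp only [θ]
    group
  have h3 : ∑ i ∈ Finset.range p, ∑ r : R, ρ ((r : K) * b ^ i * (r : K)⁻¹) =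
      (∑ r : R, ρ r) * (∑ i ∈ Finset.range p, (ρ b) ^ i) +
        ((Fintype.card R : AddMonoid.End V) - ∑ r : R, ρ r) := by
    have h4 : ∀ i ∈ Finset.range p, ∑ r : R, ρ ((r : K) * b ^ i * (r : K)⁻¹) =
        (∑ r : R, ρ r) * (ρ b) ^ i +
          if i = 0 then (Fintype.card R : AddMonoid.End V) - ∑ r : R, ρ r else 0 := by
      intro i hi
      split_ifs with h0
      · simp [h0]
      · rw [add_zero]
        exact h2 i (Nat.not_dvd_of_pos_of_lt (Nat.pos_of_ne_zero h0) (Finset.mem_range.1 hi))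
    rw [Finset.sum_congr rfl h4, Finset.sum_add_distrib, Finset.sum_ite_eq' (Finset.range p) 0,
      if_pos (Finset.mem_range.2 hp.pos), Finset.mul_sum]
  rw [Finset.sum_comm, h3, hNb, mul_zero, zero_add, sub_eq_zero] at h1
  have h4 := congrArg (fun f : AddMonoid.End V => f v) h1
  have h5 : ((∑ r : R, ρ r : AddMonoid.End V)) v = ∑ r : R, ρ r v :=
    map_sum (AddMonoidHom.eval v : (V →+ V) →+ V) _ _
  rw [← h5, ← h4]
  simp

end Norms

section Coprime

open scoped IsMulCommutative

variable {K : Type*} [Group K]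

/-- The action of a group by conjugation on a commutative normal subgroup, written additively. -/
def conjEnd (Z : Subgroup K) [Z.Normal] [IsMulCommutative Z] :
    K →* AddMonoid.End (Additive Z) where
  toFun g := MonoidHom.toAdditive (MulAut.conjNormal g : Z ≃* Z).toMonoidHom
  map_one' := by
    ext v
    exact congrArg (fun f : MulAut Z => ((f v.toMul : Z) : K)) (map_one MulAut.conjNormal)
  map_mul' g h := by
    ext v
    exact congrArg (fun f : MulAut Z => ((f v.toMul : Z) : K)) (map_mul MulAut.conjNormal g h)

theorem FixedPointFree.conjEnd {Z : Subgroup K} [Z.Normal] [IsMulCommutative Z] {b : K}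
    (h : FixedPointFree Z b) (v : Additive Z) (hv : conjEnd Z b v = v) : v = 0 := by
  have h1 : b * (v.toMul : K) * b⁻¹ = v.toMul := congrArg (fun w => (w.toMul : K)) hv
  have h2 := h _ v.toMul.2 (mul_inv_eq_iff_eq_mul.1 h1).symm
  exact congrArg Additive.ofMul (Subtype.ext h2 : v.toMul = 1)

/-- The abelian case of `FixedPointFree.commute_of_coprime`. -/
theorem FixedPointFree.commute_of_coprime_of_isMulCommutative [Finite K] {Z R : Subgroup K}
    [Z.Normal] [IsMulCommutative Z] {b : K} {p : ℕ} (hp : p.Prime) (hb : b ^ p = 1)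
    (hbR : ∀ r ∈ R, b * r * b⁻¹ ∈ R) (hR : FixedPointFree R b) (hZ : FixedPointFree Z b)
    (hcop : (Nat.card R).Coprime (Nat.card Z)) {r : K} (hr : r ∈ R) {z : K} (hz : z ∈ Z) :
    r * z = z * r := by
  classical
  let _ : Fintype R := Fintype.ofFinite R
  have key := card_nsmul_eq_sum_of_fixedPointFree (Engel.conjEnd Z) R hp hb hbR hR hZ.conjEnd
    (Additive.ofMul ⟨z, hz⟩)
  set v : Additive Z := Additive.ofMul ⟨z, hz⟩ with hv
  have h1 : Fintype.card R • (Engel.conjEnd Z r v) = Fintype.card R • v := by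
    rw [← map_nsmul, key, map_sum,
      ← Equiv.sum_comp (Equiv.mulLeft (⟨r, hr⟩ : R)) fun s : R => Engel.conjEnd Z s v]
    refine Finset.sum_congr rfl fun s _ => ?_
    simp [map_mul]
  have h2 : Fintype.card R • (Engel.conjEnd Z r v - v) = 0 := by rw [smul_sub, h1, sub_self]
  have h3 : Engel.conjEnd Z r v - v = 0 := by
    rw [← AddMonoid.addOrderOf_eq_one_iff]
    have h4 := addOrderOf_dvd_of_nsmul_eq_zero h2
    have h5 : addOrderOf (Engel.conjEnd Z r v - v) ∣ Nat.card Z :=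
      addOrderOf_dvd_natCard (G := Additive Z) _
    rw [← Nat.card_eq_fintype_card] at h4
    exact Nat.eq_one_of_dvd_coprimes hcop h4 h5
  have h6 : r * z * r⁻¹ = z := by
    have := congrArg (fun w : Additive Z => (w.toMul : K)) (sub_eq_zero.1 h3)
    exact this
  exact mul_inv_eq_iff_eq_mul.1 h6

/-- Let `b` have prime order and normalise `R`, and let `N` be a normal nilpotent subgroup of order
prime to `|R|`. If `b` acts without fixed points on both `R` and `N`, then `R` centralises `N`. -/
theorem FixedPointFree.commute_of_coprime : ∀ (n : ℕ) {K : Type*} [Group K] [Finite K]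
    {N R : Subgroup K} (_ : N.Normal) (_ : Group.IsNilpotent N) {b : K} {p : ℕ} (_ : p.Prime)
    (_ : b ^ p = 1) (_ : ∀ r ∈ R, b * r * b⁻¹ ∈ R) (_ : FixedPointFree R b)
    (_ : FixedPointFree N b) (_ : (Nat.card R).Coprime (Nat.card N)) (_ : Nat.card N ≤ n)
    {r : K} (_ : r ∈ R) {x : K} (_ : x ∈ N), r * x = x * r := by
  intro n
  induction n with
  | zero =>
    intro K _ _ N R _ _ b p _ _ _ _ _ _ hn
    exact absurd hn (by have := Nat.card_pos (α := N); omega)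
  | succ n ih =>
    intro K _ _ N R hN hnil b p hp hb hbR hR hNb hcop hn r hr x hx
    rcases subsingleton_or_nontrivial N with hs | hs
    · have : x = 1 := congrArg Subtype.val (Subsingleton.elim (⟨x, hx⟩ : N) 1)
      rw [this]; simp
    set Z : Subgroup K := (Subgroup.center N).map N.subtype with hZdef
    have hZN : Z ≤ N := Subgroup.map_subtype_le _
    have hZ1 : Z ≠ ⊥ := by
      rw [hZdef, Ne, Subgroup.map_eq_bot_iff_of_injective _ N.subtype_injective]
      exact Group.IsNilpotent.center_ne_bot N
    have hZn : Z.Normal := inferInstance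
    have hcopZ : (Nat.card R).Coprime (Nat.card Z) :=
      hcop.coprime_dvd_right (Subgroup.card_dvd_of_le hZN)
    have hRZ : ∀ s ∈ R, ∀ z ∈ Z, s * z = z * s := fun s hs z hz =>
      FixedPointFree.commute_of_coprime_of_isMulCommutative hp hb hbR hR (hNb.mono hZN) hcopZ hs hz
    have hNZ : ∀ y ∈ N, ∀ z ∈ Z, y * z = z * y := by
      rintro y hy _ ⟨z, hz, rfl⟩
      exact congrArg Subtype.val (Subgroup.mem_center_iff.1 hz ⟨y, hy⟩)
    set π := QuotientGroup.mk' Z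
    -- pass to the quotient by `Z = Z(N)`
    have hcard : Nat.card (N.map π) < Nat.card N := by
      by_contra hle
      have h1 := (π.subgroupMap_surjective N).bijective_of_nat_card_le (not_lt.1 hle)
      refine hZ1 ((Subgroup.eq_bot_iff_forall Z).2 fun z hz => ?_)
      have h2 : π.subgroupMap N ⟨z, hZN hz⟩ = π.subgroupMap N 1 := by
        rw [map_one]
        refine Subtype.ext ?_
        change π z = 1
        rw [← MonoidHom.mem_ker, QuotientGroup.ker_mk']
        exact hz
      exact congrArg Subtype.val (h1.1 h2)
    have hRπ : FixedPointFree (R.map π) (π b) := by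
      rintro _ ⟨s, hs, rfl⟩ hc
      have h1 : s * b * s⁻¹ * b⁻¹ ∈ Z := by
        rw [← QuotientGroup.ker_mk' Z, MonoidHom.mem_ker]
        simp only [map_mul, map_inv]
        change π s * π b * (π s)⁻¹ * (π b)⁻¹ = 1
        rw [hc]; group
      have h2 : s * b * s⁻¹ * b⁻¹ ∈ R := by
        have := R.mul_mem hs (hbR _ (R.inv_mem hs))
        simpa [mul_assoc] using this
      have h3 : s * b * s⁻¹ * b⁻¹ = 1 := by
        exact Subgroup.disjoint_def.1 (Subgroup.disjoint_of_coprime_natCard hcopZ) h2 h1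
      rw [hR s hs (by rw [mul_inv_eq_one, mul_inv_eq_iff_eq_mul] at h3; exact h3), map_one]
    have h1 : π r * π x = π x * π r := by
      refine ih (N := N.map π) (R := R.map π) (hN.map π (QuotientGroup.mk'_surjective Z)) ?_ hp
        (b := π b) (by rw [← map_pow, hb, map_one]) ?_ hRπ (hNb.map_mk hZN) ?_ ?_ ⟨r, hr, rfl⟩
        ⟨x, hx, rfl⟩
      · exact Group.nilpotent_of_surjective _ (π.subgroupMap_surjective N)
      · rintro _ ⟨s, hs, rfl⟩
        exact ⟨_, hbR s hs, by simp⟩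
      · exact (hcop.coprime_dvd_left (Subgroup.card_map_dvd _ _)).coprime_dvd_right
          (Subgroup.card_map_dvd _ _)
      · omega
    -- `r` acts on the coset `xZ` by multiplication with an element of `Z`
    have hz : x⁻¹ * r * x * r⁻¹ ∈ Z := by
      rw [← QuotientGroup.ker_mk' Z, MonoidHom.mem_ker]
      simp only [map_mul, map_inv]
      change (π x)⁻¹ * π r * π x * (π r)⁻¹ = 1
      rw [mul_assoc (π x)⁻¹, h1]; group
    set z := x⁻¹ * r * x * r⁻¹ with hzdef
    have hrx : ∀ k : ℕ, r ^ k * x = x * (z ^ k * r ^ k) := by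
      intro k
      induction k with
      | zero => simp
      | succ k ihk =>
        have h2 : r * x = x * z * r := by rw [hzdef]; group
        have h3 : r * z ^ k = z ^ k * r := hRZ r hr _ (Z.pow_mem hz k)
        calc r ^ (k + 1) * x = r * (r ^ k * x) := by rw [pow_succ']; group
          _ = (r * x) * (z ^ k * r ^ k) := by rw [ihk]; group
          _ = x * z * (r * z ^ k) * r ^ k := by rw [h2]; group
          _ = x * (z ^ (k + 1) * r ^ (k + 1)) := by rw [h3, pow_succ' z, pow_succ' r]; group
    have hz1 : z ^ Nat.card R = 1 := by
      have h2 := hrx (Nat.card R)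
      have h3 : r ^ Nat.card R = 1 := by
        exact congrArg Subtype.val (pow_card_eq_one' (x := (⟨r, hr⟩ : R)))
      rw [h3, one_mul, mul_one] at h2
      exact (left_eq_mul.1 h2)
    have hz2 : z = 1 := by
      rw [← orderOf_eq_one_iff]
      refine Nat.eq_one_of_dvd_coprimes hcopZ (orderOf_dvd_of_pow_eq_one hz1) ?_
      have := orderOf_dvd_natCard (⟨z, hz⟩ : Z)
      rwa [Subgroup.orderOf_mk] at this
    have h4 := hrx 1
    rw [hz2] at h4
    simpa using h4

end Coprime

/-! ### Cyclicity of groups acting without fixed points -/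

section Cyclic

/-- For odd `p` and `k ≡ 1 (mod p)` the number `1 + k + ⋯ + k ^ (p - 1)` is divisible by `p` exactly
once. -/
theorem geom_sum_modEq_sq {p : ℕ} (hp : Odd p) {k : ℤ} (hk : k ≡ 1 [ZMOD p]) :
    ∑ i ∈ Finset.range p, k ^ i ≡ p [ZMOD (p : ℤ) ^ 2] := by
  obtain ⟨a, ha⟩ := hk.symm.dvd
  have hk' : k = 1 + p * a := by linarith
  have h1 : ∀ i : ℕ, k ^ i ≡ 1 + i * (p * a) [ZMOD (p : ℤ) ^ 2] := by
    intro i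
    induction i with
    | zero => simp
    | succ i ih =>
      rw [pow_succ k]
      refine (ih.mul_right k).trans (Int.modEq_iff_dvd.2 ⟨-(i * a ^ 2), ?_⟩)
      rw [hk']; push_cast; ring
  have h2 : ∑ i ∈ Finset.range p, k ^ i ≡
      ∑ i ∈ Finset.range p, (1 + i * (p * a)) [ZMOD (p : ℤ) ^ 2] := Int.ModEq.sum fun i _ => h1 i
  refine h2.trans ?_
  obtain ⟨m, hm⟩ := hp
  have h3 : (∑ i ∈ Finset.range p, (i : ℤ)) = p * m := by
    have h4 := Finset.sum_range_id_mul_two p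
    have h5 : p - 1 = m * 2 := by omega
    rw [h5, ← mul_assoc] at h4
    have h6 : ∑ i ∈ Finset.range p, i = p * m := by omega
    rw [← Nat.cast_sum, h6, Nat.cast_mul]
  rw [Finset.sum_add_distrib, ← Finset.sum_mul, h3]
  refine Int.modEq_iff_dvd.2 ⟨-(m * a), ?_⟩
  simp only [Finset.sum_const, Finset.card_range, nsmul_eq_mul, mul_one]
  ring

/-- A finite `p`-group, `p` odd, with at most one subgroup of order `p` is cyclic. -/
theorem isCyclic_of_forall_mem_zpowers {p : ℕ} (hp : p.Prime) (hodd : Odd p) :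
    ∀ (n : ℕ) {G : Type*} [Group G], Nat.card G = p ^ n →
      (∀ x y : G, x ^ p = 1 → y ^ p = 1 → y ≠ 1 → x ∈ Subgroup.zpowers y) → IsCyclic G := by
  have := Fact.mk hp
  intro n
  induction n with
  | zero =>
    intro G _ hG _
    have : Subsingleton G := (Nat.card_eq_one_iff_unique.1 (by simpa using hG)).1
    infer_instance
  | succ n ih =>
    intro G _ hG h
    by_contra hcyc
    have hfin : Finite G := Nat.finite_of_card_ne_zero (by rw [hG]; exact (pow_pos hp.pos _).ne')
    -- a cyclic normal subgroup `M = ⟨m⟩` of index `p`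
    obtain ⟨M, hM⟩ := Sylow.exists_subgroup_card_pow_prime (G := G) p (n := n)
      (by rw [hG]; exact pow_dvd_pow _ n.le_succ)
    have hidx : M.index = p := by
      have h1 := M.card_mul_index
      rw [hM, hG, pow_succ] at h1
      exact Nat.eq_of_mul_eq_mul_left (pow_pos hp.pos n) h1
    have hMn : M.Normal := Subgroup.normal_of_index_eq_minFac_card (by
      rw [hidx, hG, hp.pow_minFac n.succ_ne_zero])
    have hMc : IsCyclic M := by
      refine ih hM fun x y hx hy hy1 => ?_
      obtain ⟨k, hk⟩ := h x y (by simpa [Subtype.ext_iff] using hx)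
        (by simpa [Subtype.ext_iff] using hy) (by simpa using hy1)
      exact ⟨k, Subtype.ext (by simpa using hk)⟩
    obtain ⟨⟨m, hmM⟩, hm⟩ := hMc.exists_generator
    have hm' : ∀ y ∈ M, ∃ k : ℤ, m ^ k = y := fun y hy => by
      obtain ⟨k, hk⟩ := hm ⟨y, hy⟩
      exact ⟨k, by simpa [Subtype.ext_iff] using hk⟩
    have hord : orderOf m = p ^ n := by
      rw [← hM, ← orderOf_eq_card_of_forall_mem_zpowers hm, Subgroup.orderOf_mk]
    have hn : n ≠ 0 := by
      rintro rfl
      exact hcyc (isCyclic_of_prime_card (p := p) (by simpa using hG))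
    obtain ⟨x, hx⟩ : ∃ x, x ∉ M := by
      by_contra! hall
      rw [(Subgroup.eq_top_iff' M).2 hall, Subgroup.index_top] at hidx
      exact hp.one_lt.ne hidx
    have hxp : x ^ p ∈ M := by
      rw [← hidx]; exact M.pow_index_mem x
    obtain ⟨i, hi⟩ := hm' _ hxp
    obtain ⟨k, hk⟩ := hm' _ (hMn.conj_mem m hmM x)
    -- `x` has order less than `|G|`, so `i` is divisible by `p`
    have hxn : x ^ p ^ n = 1 := by
      obtain ⟨j, hj, hj'⟩ := (Nat.dvd_prime_pow hp).1 (hG ▸ orderOf_dvd_natCard x)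
      rcases Nat.lt_or_ge n j with h1 | h1
      · exact absurd (isCyclic_of_card_le_orderOf x (by
          rw [hG, hj']; exact Nat.pow_le_pow_right hp.pos h1)) hcyc
      · exact orderOf_dvd_iff_pow_eq_one.1 (hj' ▸ pow_dvd_pow p h1)
    obtain ⟨n', rfl⟩ := Nat.exists_eq_succ_of_ne_zero hn
    obtain ⟨i', rfl⟩ : (p : ℤ) ∣ i := by
      have h1 : m ^ (i * (p : ℤ) ^ n') = 1 := by
        rw [zpow_mul, hi, ← hxn, pow_succ', pow_mul]
        exact_mod_cast zpow_natCast (x ^ p) (p ^ n')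
      rw [← orderOf_dvd_iff_zpow_eq_one, hord, Nat.succ_eq_add_one, pow_succ'] at h1
      push_cast at h1
      exact Int.dvd_of_mul_dvd_mul_right (pow_ne_zero _ (by exact_mod_cast hp.ne_zero)) h1
    have hconj : ∀ t : ℤ, x * m ^ t = m ^ (k * t) * x := by
      intro t
      rw [zpow_mul, hk, conj_zpow]; group
    have hkp : k ≡ 1 [ZMOD p] := by
      have h1 : ∀ t : ℕ, x ^ t * m = m ^ (k ^ t) * x ^ t := by
        intro t
        induction t with
        | zero => simp
        | succ t iht =>
          rw [pow_succ', mul_assoc, iht, ← mul_assoc, hconj, pow_succ' k, mul_assoc]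
      have h2 := h1 p
      rw [← hi, ← zpow_add_one, ← zpow_add, add_comm, zpow_add, zpow_add] at h2
      have h3 : m ^ (k ^ p - 1) = 1 := by
        rw [zpow_sub, ← mul_right_cancel h2]; simp
      rw [← orderOf_dvd_iff_zpow_eq_one, hord] at h3
      have h4 : (p : ℤ) ∣ k ^ p - 1 := (Dvd.intro_left (p ^ n' : ℤ) (by
          rw [Nat.succ_eq_add_one]; push_cast; ring)).trans h3
      have h5 : ((k ^ p - 1 : ℤ) : ZMod p) = 0 := (ZMod.intCast_zmod_eq_zero_iff_dvd _ _).2 h4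
      push_cast at h5
      rw [ZMod.pow_card, sub_eq_zero] at h5
      exact (ZMod.intCast_eq_intCast_iff k 1 p).1 (by simpa using h5)
    obtain ⟨c, hc⟩ := (geom_sum_modEq_sq hodd hkp).symm.dvd
    have hS : ∑ i ∈ Finset.range p, k ^ i = p * (1 + p * c) := by linear_combination hc
    have hpow : ∀ (j : ℤ) (t : ℕ),
        (m ^ j * x) ^ t = m ^ (j * ∑ i ∈ Finset.range t, k ^ i) * x ^ t := by
      intro j t
      induction t with
      | zero => simp
      | succ t iht =>
        calc (m ^ j * x) ^ (t + 1) =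
            m ^ j * (x * m ^ (j * ∑ i ∈ Finset.range t, k ^ i)) * x ^ t := by
              rw [pow_succ', iht]; group
          _ = m ^ j * m ^ (k * (j * ∑ i ∈ Finset.range t, k ^ i)) * x ^ (t + 1) := by
              rw [hconj, pow_succ']; group
          _ = _ := by rw [← zpow_add, geom_sum_succ]; ring_nf
    -- an element of order `p` outside of `M`
    have hcop : IsCoprime (1 + (p : ℤ) * c) ((p : ℤ) ^ (n' + 1)) :=
      IsCoprime.pow_right ⟨1, -c, by ring⟩
    obtain ⟨a, b, hab⟩ := hcop
    have hw : (m ^ (-(a * i')) * x) ^ p = 1 := by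
      rw [hpow, ← hi, ← zpow_add, hS, ← orderOf_dvd_iff_zpow_eq_one, hord]
      refine ⟨p * i' * b, ?_⟩
      rw [Nat.succ_eq_add_one]
      push_cast
      linear_combination (-(p : ℤ) * i') * hab
    have hv : (m ^ p ^ n') ^ p = 1 := by
      rw [← pow_mul, ← pow_succ, ← hord, pow_orderOf_eq_one]
    have hv1 : m ^ p ^ n' ≠ 1 := by
      intro h1
      have h2 := orderOf_dvd_of_pow_eq_one h1
      rw [hord] at h2
      exact absurd (Nat.le_of_dvd (pow_pos hp.pos _) h2)
        (not_le.2 (Nat.pow_lt_pow_right hp.one_lt n'.lt_succ_self))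
    have h1 := h _ _ hw hv hv1
    have h2 : m ^ (-(a * i')) * x ∈ M :=
      (Subgroup.zpowers_le.2 (M.pow_mem hmM _)) h1
    exact hx ((M.mul_mem_cancel_left (M.zpow_mem hmM _)).1 h2)

end Cyclic

section Eigenvector

/-- An automorphism `T ≠ 1` with `T ^ p = 1` of an elementary abelian `q`-group, where `p ∣ q - 1`,
has an eigenvector for an eigenvalue different from `1`. -/
theorem exists_eigenvector_of_dvd {V : Type*} [AddCommGroup V] {p q : ℕ} (hp : p.Prime)
    (hq : q.Prime) (hpq : p ∣ q - 1) [Module (ZMod q) V] (T : AddMonoid.End V)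
    (hT : T ^ p = 1) (hT1 : T ≠ 1) : ∃ (v : V) (k : ℕ), T v = k • v ∧ T v ≠ v := by
  have := Fact.mk hq
  have := Fact.mk hp
  let L : V →ₗ[ZMod q] V := AddMonoidHom.toZModLinearMap q T
  have hL : ∀ v : V, L v = T v := fun _ => rfl
  have hLpow : ∀ (n : ℕ) (v : V), (L ^ n) v = (T ^ n) v := by
    intro n
    induction n with
    | zero => intro v; rfl
    | succ n ih =>
      intro v
      rw [pow_succ, pow_succ]
      exact ih (T v)
  have hLp : L ^ p = 1 := by
    ext v
    rw [hLpow, hT]; rfl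
  obtain ⟨u, hu⟩ := exists_prime_orderOf_dvd_card' (G := (ZMod q)ˣ) p
    (by rwa [Nat.card_eq_fintype_card, ZMod.card_units])
  have hζ : IsPrimitiveRoot (u : ZMod q) p := by
    rw [← hu, ← orderOf_units]
    exact IsPrimitiveRoot.orderOf _
  by_contra! hno
  have hinj : ∀ μ : ZMod q, μ ≠ 1 →
      Function.Injective (Polynomial.aeval L (Polynomial.X - Polynomial.C μ)) := by
    intro μ hμ
    rw [injective_iff_map_eq_zero]
    intro v hv
    have h1 : L v = μ • v := by
      simpa [sub_eq_zero, Module.algebraMap_end_apply] using hv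
    have h2 : L v = μ.val • v := by
      rw [h1, ← Nat.cast_smul_eq_nsmul (ZMod q), ZMod.natCast_zmod_val]
    have h3 : L v = v := hno v _ h2
    rw [h3] at h1
    have h4 : (μ - 1) • v = 0 := by rw [sub_smul, one_smul, ← h1, sub_self]
    exact (smul_eq_zero.1 h4).resolve_left (sub_ne_zero.2 hμ)
  classical
  have h1mem : (1 : ZMod q) ∈ Polynomial.nthRootsFinset p (1 : ZMod q) :=
    (Polynomial.mem_nthRootsFinset hp.pos _).2 (one_pow p)
  have hfac := Polynomial.X_pow_sub_one_eq_prod hp.pos hζ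
  rw [← Finset.prod_erase_mul _ _ h1mem] at hfac
  have hprod : Function.Injective (Polynomial.aeval L
      (∏ μ ∈ (Polynomial.nthRootsFinset p (1 : ZMod q)).erase 1,
        (Polynomial.X - Polynomial.C μ))) := by
    refine Finset.prod_induction _ (fun f => Function.Injective (Polynomial.aeval L f))
      (fun f g hf hg => ?_) ?_ fun μ hμ => hinj μ (Finset.ne_of_mem_erase hμ)
    · rw [map_mul]; exact hf.comp hg
    · rw [map_one]; exact fun _ _ h => h
  refine hT1 ?_
  ext v
  have h5 := congrArg (fun f => Polynomial.aeval L f v) hfac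
  simp only [map_sub, map_pow, Polynomial.aeval_X, map_one, hLp, sub_self, map_mul]
    at h5
  have h6 : (L - 1) v = 0 := by
    apply hprod
    rw [map_zero]
    exact h5.symm
  exact sub_eq_zero.1 h6

/-- In a finite `q`-group all commutators and `q`-th powers lie in the Frattini subgroup. -/
theorem mem_frattini_of_isPGroup {R : Type*} [Group R] [Finite R] {q : ℕ} (hq : q.Prime)
    (hR : IsPGroup q R) (x y : R) : x ^ q ∈ frattini R ∧ x * y * x⁻¹ * y⁻¹ ∈ frattini R := by
  have := Fact.mk hq
  have hnil : Group.IsNilpotent R := hR.isNilpotent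
  have key : ∀ M : Subgroup R, IsCoatom M → x ^ q ∈ M ∧ x * y * x⁻¹ * y⁻¹ ∈ M := by
    intro M hM
    have hMn : M.Normal :=
      Subgroup.NormalizerCondition.normal_of_coatom M Group.normalizerCondition_of_isNilpotent hM
    have hgen : ∀ g ∉ M, ∀ y, ∃ k : ℤ, ∃ m ∈ M, g ^ k * m = y := by
      intro g hg y
      have h1 : Subgroup.zpowers g ⊔ M = ⊤ := hM.2 _ (lt_of_le_of_ne le_sup_right fun h =>
        hg (h ▸ (le_sup_left (a := Subgroup.zpowers g)) (Subgroup.mem_zpowers g)))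
      obtain ⟨_, ⟨k, rfl⟩, m, hm, h2⟩ :=
        Subgroup.mem_sup_of_normal_right.1 (h1 ▸ Subgroup.mem_top y)
      exact ⟨k, m, hm, h2⟩
    constructor
    · by_contra hx
      obtain ⟨k, m, hm, h1⟩ := hgen _ hx x
      have h2 : x ^ (1 - q * k) ∈ M := by
        have : x ^ (1 - q * k) = (x ^ q) ^ k * m * ((x ^ q) ^ k)⁻¹ := by
          rw [h1, sub_eq_add_neg, zpow_add, zpow_one, zpow_neg, zpow_mul, zpow_natCast]
        rw [this]
        exact hMn.conj_mem m hm _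
      obtain ⟨n, hn⟩ := hR x
      have hcop : IsCoprime (1 - (q : ℤ) * k) ((q : ℤ) ^ n) := IsCoprime.pow_right ⟨1, k, by ring⟩
      obtain ⟨a, b, hab⟩ := hcop
      have h3 : x = (x ^ (1 - q * k)) ^ a := by
        have h4 : x ^ ((q : ℤ) ^ n) = 1 := by exact_mod_cast hn
        calc x = x ^ (a * (1 - q * k) + b * (q : ℤ) ^ n) := by rw [hab, zpow_one]
          _ = _ := by
            rw [zpow_add, mul_comm b, zpow_mul x _ b, h4, one_zpow, mul_one, mul_comm a, zpow_mul]
      exact hx (M.pow_mem (h3 ▸ M.zpow_mem h2 a) q)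
    · by_cases hx : x ∈ M
      · have := M.mul_mem hx (hMn.conj_mem _ (M.inv_mem hx) y)
        simpa [mul_assoc] using this
      · obtain ⟨k, m, hm, rfl⟩ := hgen _ hx y
        have h1 : x * (x ^ k * m) * x⁻¹ * (x ^ k * m)⁻¹ =
            x ^ k * ((x * m * x⁻¹) * m⁻¹) * (x ^ k)⁻¹ := by
          rw [mul_inv_rev, ← mul_assoc x (x ^ k) m, ← zpow_one_add, add_comm, zpow_add_one]
          group
        rw [h1]
        exact hMn.conj_mem _ (M.mul_mem (hMn.conj_mem m hm x) (M.inv_mem hm)) _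
  simp only [frattini, Order.radical, Subgroup.mem_iInf]
  exact ⟨fun M hM => (key M hM).1, fun M hM => (key M hM).2⟩

open scoped IsMulCommutative in
/-- Let `φ` be a non-trivial automorphism with `φ ^ p = 1` of a finite `q`-group `R`, where
`p ∣ q - 1`. If `φ` is trivial on all proper invariant subgroups, then `R` is cyclic: `φ` has an
eigenvector in the Frattini quotient, and this eigenvector generates `R`. -/
theorem isCyclic_of_minimal_action {R : Type*} [Group R] [Finite R] {p q : ℕ} (hp : p.Prime)
    (hq : q.Prime) (hpq : p ∣ q - 1) (hR : IsPGroup q R) (φ : MulAut R) (hφp : φ ^ p = 1)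
    (hφ : φ ≠ 1) (hmin : ∀ S : Subgroup R, (∀ x ∈ S, φ x ∈ S) → S ≠ ⊤ → ∀ x ∈ S, φ x = x) :
    IsCyclic R := by
  have := Fact.mk hq
  set N := frattini R with hN
  have hnt : Nontrivial R := by
    by_contra h
    rw [not_nontrivial_iff_subsingleton] at h
    exact hφ (MulEquiv.ext fun x => Subsingleton.elim _ _)
  have hNtop : N ≠ ⊤ := by
    intro h
    have h1 : (⊥ : Subgroup R) = ⊤ := frattini_nongenerating (by rw [← hN, h, bot_sup_eq])
    exact bot_ne_top h1
  have hNφ : ∀ x ∈ N, φ x ∈ N := fun x hx => by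
    have := Subgroup.characteristic_iff_map_eq.1 (frattini_characteristic (G := R)) φ
    rw [hN, ← this]
    exact ⟨x, hx, rfl⟩
  have hNfix := hmin N hNφ hNtop
  let π := QuotientGroup.mk' N
  have hcomm : IsMulCommutative (R ⧸ N) := by
    refine ⟨⟨fun a b => ?_⟩⟩
    induction a using QuotientGroup.induction_on with
    | H a =>
      induction b using QuotientGroup.induction_on with
      | H b =>
        have h1 := (mem_frattini_of_isPGroup hq hR a b).2
        rw [← hN, ← QuotientGroup.eq_one_iff] at h1
        exact mul_inv_eq_iff_eq_mul.1 (mul_inv_eq_one.1 h1)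
  let τ : R ⧸ N →* R ⧸ N := QuotientGroup.map N N φ.toMonoidHom hNφ
  let T : AddMonoid.End (Additive (R ⧸ N)) := MonoidHom.toAdditive τ
  have hTπ : ∀ x : R, T (Additive.ofMul (π x)) = Additive.ofMul (π (φ x)) := fun _ => rfl
  have hTpow : ∀ (n : ℕ) (x : R), (T ^ n) (Additive.ofMul (π x)) =
      Additive.ofMul (π ((φ ^ n) x)) := by
    intro n
    induction n with
    | zero => intro x; rfl
    | succ n ih => intro x; rw [pow_succ, pow_succ]; exact ih (φ x)
  have hTp : T ^ p = 1 := by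
    ext v
    obtain ⟨x, hx⟩ := QuotientGroup.mk'_surjective N v.toMul
    have : v = Additive.ofMul (π x) := congrArg Additive.ofMul hx.symm
    rw [this, hTpow, hφp]; rfl
  have hT1 : T ≠ 1 := by
    intro h
    refine hφ (MulEquiv.ext fun x => ?_)
    -- `φ` is trivial on `N` and on `R/N`, and its order is prime to `|N|`
    have h1 : π (φ x) = π x := by
      have := hTπ x
      rw [h] at this
      exact (congrArg Additive.toMul this).symm
    have h2 : x⁻¹ * φ x ∈ N := QuotientGroup.eq.1 h1.symm
    set n := x⁻¹ * φ x with hn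
    have h3 : ∀ k : ℕ, (φ ^ k) x = x * n ^ k := by
      intro k
      induction k with
      | zero => simp
      | succ k ih =>
        rw [pow_succ', MulAut.mul_apply, ih, map_mul, map_pow, hNfix n h2, pow_succ']
        rw [← mul_assoc, show x * n = φ x by rw [hn]; group]
    have h4 : n ^ p = 1 := by
      have := h3 p
      rw [hφp] at this
      exact left_eq_mul.1 this
    obtain ⟨k, hk⟩ := hR n
    have h5 : n = 1 := by
      rw [← orderOf_eq_one_iff]
      refine Nat.eq_one_of_dvd_coprimes (Nat.Coprime.pow_right k ((Nat.coprime_primes hp hq).2 ?_))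
        (orderOf_dvd_of_pow_eq_one h4) (orderOf_dvd_of_pow_eq_one hk)
      rintro rfl
      exact absurd (Nat.le_of_dvd (by have := hp.two_le; omega) hpq) (by have := hp.pos; omega)
    have := h3 1
    rw [h5] at this
    simpa using this
  have hexp : ∀ v : Additive (R ⧸ N), q • v = 0 := by
    intro v
    obtain ⟨x, hx⟩ := QuotientGroup.mk'_surjective N v.toMul
    have h1 := (mem_frattini_of_isPGroup hq hR x 1).1
    rw [← hN, ← QuotientGroup.eq_one_iff] at h1
    have : v = Additive.ofMul (π x) := congrArg Additive.ofMul hx.symm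
    rw [this, ← ofMul_pow]
    exact congrArg Additive.ofMul h1
  let _ : Module (ZMod q) (Additive (R ⧸ N)) := AddCommGroup.zmodModule hexp
  obtain ⟨v, k, hv, hv1⟩ := exists_eigenvector_of_dvd hp hq hpq T hTp hT1
  obtain ⟨s, hs⟩ := QuotientGroup.mk'_surjective N v.toMul
  have hvs : v = Additive.ofMul (π s) := congrArg Additive.ofMul hs.symm
  rw [hvs, hTπ, ← ofMul_pow] at hv
  rw [hvs, hTπ] at hv1
  have h1 : π (φ s) = π s ^ k := Additive.ofMul.injective hv
  have h2 : φ s ≠ s := fun h => hv1 (by rw [h])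
  have hS : Subgroup.zpowers s ⊔ N = ⊤ := by
    by_contra hne
    have hsS : s ∈ Subgroup.zpowers s ⊔ N :=
      (le_sup_left (a := Subgroup.zpowers s)) (Subgroup.mem_zpowers s)
    refine h2 (hmin _ ?_ hne s hsS)
    have hle : Subgroup.zpowers s ⊔ N ≤ (Subgroup.zpowers s ⊔ N).comap φ.toMonoidHom := by
      refine sup_le (Subgroup.zpowers_le.2 ?_) fun x hx => ?_
      · have h3 : (s ^ k)⁻¹ * φ s ∈ N := QuotientGroup.eq.1 h1.symm
        have h4 := Subgroup.mul_mem _ (Subgroup.pow_mem _ hsS k)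
          ((le_sup_right (a := Subgroup.zpowers s)) h3)
        rw [mul_inv_cancel_left] at h4
        exact h4
      · exact (le_sup_right (a := Subgroup.zpowers s)) (hNφ x hx)
    exact hle
  have hS' := frattini_nongenerating hS
  exact isCyclic_iff_exists_zpowers_eq_top.2 ⟨s, hS'⟩

end Eigenvector

/-! ### Commuting fixed-point-free elements of different prime orders -/

section Core

variable {H : Type*} [Group H]

/-- The configuration that is left when no element at Engel distance at most two from `y` has a
fixed point on the Fitting subgroup. It is stated for the quotient `H` by the Fitting subgroup, and
`X` stands for the set of the elements of `H` that act without fixed points. -/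
structure FixedPointFreeConfig (X : Set H) (y : H) : Prop where
  ne_one : y ≠ 1
  /-- Non-trivial elements that normalise `⟨a⟩`, where `a ≠ 1` commutes with `y`, lie in `X`. -/
  mem_of_normalizes : ∀ a x : H, a ≠ 1 → Commute a y → x ≠ 1 →
    x⁻¹ * a * x ∈ Subgroup.zpowers a → x ∈ X
  /-- There is no Frobenius group `R ⋊ ⟨b⟩` with `R ≤ O_q(H)` and `b ∈ X`. -/
  eq_bot_of_fixedPointFree : ∀ p q : ℕ, p.Prime → q.Prime → p ≠ q → ∀ b ∈ X, b ^ p = 1 → b ≠ 1 →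
    ∀ R : Subgroup H, R ≤ pCore q H → (∀ r ∈ R, b * r * b⁻¹ ∈ R) → FixedPointFree R b → R = ⊥
  /-- There is no elementary abelian group of rank two in `X ∪ {1}`. -/
  mem_zpowers_of_commute : ∀ p : ℕ, p.Prime → ∀ b s : H, b ^ p = 1 → s ^ p = 1 → b ≠ 1 →
    Commute b s → (∀ i j : ℕ, b ^ i * s ^ j ≠ 1 → b ^ i * s ^ j ∈ X) → s ∈ Subgroup.zpowers b

namespace FixedPointFreeConfig

variable {X : Set H} {y : H}

theorem mem_of_commute (h : FixedPointFreeConfig X y) {a x : H} (ha : a ≠ 1) (hay : Commute a y)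
    (hx : x ≠ 1) (hxa : Commute x a) : x ∈ X := by
  refine h.mem_of_normalizes a x ha hay hx ?_
  rw [mul_assoc, ← hxa.eq, inv_mul_cancel_left]
  exact Subgroup.mem_zpowers a

/-- If `a ≠ 1` commutes with `y` and `⟨a⟩` is normal, then all non-trivial elements lie in `X`. -/
theorem forall_mem_of_normal (h : FixedPointFreeConfig X y) {a : H} (ha : a ≠ 1)
    (hay : Commute a y) (hn : ∀ x : H, x⁻¹ * a * x ∈ Subgroup.zpowers a) : ∀ x ≠ 1, x ∈ X :=
  fun x hx => h.mem_of_normalizes a x ha hay hx (hn x)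

/-- An element of `X` of prime order `p ≠ q` centralises the abelian subgroups of `O_q(H)` that it
normalises. -/
theorem commute_of_abelian [Finite H] (h : FixedPointFreeConfig X y) {p q : ℕ} (hp : p.Prime)
    (hq : q.Prime) (hpq : p ≠ q) {b : H} (hbX : b ∈ X) (hbp : b ^ p = 1) (hb : b ≠ 1)
    {R : Subgroup H} (hRq : R ≤ pCore q H) (hbR : ∀ r ∈ R, b * r * b⁻¹ ∈ R)
    (hR : ∀ r ∈ R, ∀ s ∈ R, r * s = s * r) {r : H} (hr : r ∈ R) : r * b = b * r := by
  -- the image of the homomorphism `r ↦ [r, b]` of `R`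
  let R₁ : Subgroup H :=
    { carrier := {u | ∃ r ∈ R, r * (b * r⁻¹ * b⁻¹) = u}
      one_mem' := ⟨1, R.one_mem, by simp⟩
      mul_mem' := by
        rintro _ _ ⟨r, hr, rfl⟩ ⟨s, hs, rfl⟩
        refine ⟨r * s, R.mul_mem hr hs, ?_⟩
        have h1 := hR _ (R.mul_mem hs (hbR _ (R.inv_mem hs))) _ (hbR _ (R.inv_mem hr))
        calc r * s * (b * (r * s)⁻¹ * b⁻¹) =
            r * ((s * (b * s⁻¹ * b⁻¹)) * (b * r⁻¹ * b⁻¹)) := by group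
          _ = _ := by rw [h1]; group
      inv_mem' := by
        rintro _ ⟨r, hr, rfl⟩
        refine ⟨r⁻¹, R.inv_mem hr, ?_⟩
        have h1 := hR _ (R.inv_mem hr) _ (hbR _ hr)
        rw [inv_inv, h1]
        group }
  have hR₁R : R₁ ≤ R := by
    rintro _ ⟨r, hr, rfl⟩
    exact R.mul_mem hr (hbR _ (R.inv_mem hr))
  have h1 : R₁ = ⊥ := by
    refine h.eq_bot_of_fixedPointFree p q hp hq hpq b hbX hbp hb R₁ (hR₁R.trans hRq) ?_ ?_
    · rintro _ ⟨r, hr, rfl⟩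
      exact ⟨b * r * b⁻¹, hbR r hr, by group⟩
    · intro u hu hub
      obtain ⟨r, hr, hru⟩ := hu
      have hu' : u ∈ R := hR₁R ⟨r, hr, hru⟩
      have h2 : b * r * b⁻¹ = u⁻¹ * r := by
        rw [← hru]; group
      have h3 : ∀ k : ℕ, b ^ k * r * (b ^ k)⁻¹ = (u⁻¹) ^ k * r := by
        intro k
        induction k with
        | zero => simp
        | succ k ih =>
          have h4 : Commute b ((u⁻¹) ^ k) := (show Commute u b from hub).symm.inv_right.pow_right k
          calc b ^ (k + 1) * r * (b ^ (k + 1))⁻¹ = b * (b ^ k * r * (b ^ k)⁻¹) * b⁻¹ := by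
                rw [pow_succ']; group
            _ = (b * (u⁻¹) ^ k) * r * b⁻¹ := by rw [ih]; group
            _ = (u⁻¹) ^ k * (b * r * b⁻¹) := by rw [h4.eq]; group
            _ = (u⁻¹) ^ (k + 1) * r := by rw [h2, pow_succ]; group
      have h4 := h3 p
      rw [hbp, inv_one, mul_one, one_mul, right_eq_mul] at h4
      obtain ⟨k, hk⟩ := exists_pow_eq_one_of_mem (pCore_isPGroup q) (hRq hu')
      have h5 : u ^ p = 1 := by simpa using h4
      rw [← orderOf_eq_one_iff]
      exact Nat.eq_one_of_dvd_coprimes (Nat.Coprime.pow_right k ((Nat.coprime_primes hp hq).2 hpq))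
        (orderOf_dvd_of_pow_eq_one h5) (orderOf_dvd_of_pow_eq_one hk)
  have h2 : r * (b * r⁻¹ * b⁻¹) ∈ R₁ := ⟨r, hr, rfl⟩
  rw [h1, Subgroup.mem_bot] at h2
  calc r * b = (r * (b * r⁻¹ * b⁻¹)) * (b * r) := by group
    _ = b * r := by rw [h2, one_mul]

theorem exists_prime_pow [Finite H] {p : ℕ} (hp : p.Prime) {y : H} (h : p ∣ orderOf y) :
    ∃ m : ℕ, y ^ m ≠ 1 ∧ (y ^ m) ^ p = 1 := by
  refine ⟨orderOf y / p, fun h1 => ?_, ?_⟩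
  · have h2 := orderOf_dvd_of_pow_eq_one h1
    exact absurd (Nat.le_of_dvd (Nat.div_pos (Nat.le_of_dvd (orderOf_pos y) h) hp.pos) h2)
      (not_le.2 (Nat.div_lt_self (orderOf_pos y) hp.one_lt))
  · rw [← pow_mul, Nat.div_mul_cancel h, pow_orderOf_eq_one]

/-- The elements of order dividing `q` of the center of `O_q(H)`. -/
def centerSocle (q : ℕ) (H : Type*) [Group H] : Subgroup H where
  carrier := {v | v ∈ pCore q H ∧ (∀ x ∈ pCore q H, x * v = v * x) ∧ v ^ q = 1}
  one_mem' := ⟨one_mem _, fun x _ => by simp, one_pow q⟩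
  mul_mem' := by
    rintro u v ⟨hu, hu1, hu2⟩ ⟨hv, hv1, hv2⟩
    refine ⟨mul_mem hu hv, fun x hx => ?_, ?_⟩
    · rw [← mul_assoc, hu1 x hx, mul_assoc, hv1 x hx, mul_assoc]
    · rw [(show Commute u v from hv1 u hu).mul_pow, hu2, hv2, one_mul]
  inv_mem' := by
    rintro u ⟨hu, hu1, hu2⟩
    exact ⟨inv_mem hu, fun x hx => (show Commute x u from hu1 x hx).inv_right.eq, by simp [hu2]⟩

instance centerSocle_normal (q : ℕ) : (centerSocle q H).Normal where
  conj_mem := by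
    rintro u ⟨hu, hu1, hu2⟩ g
    refine ⟨(pCore_normal q).conj_mem u hu g, fun x hx => ?_, by rw [conj_pow, hu2]; group⟩
    have h1 := hu1 (g⁻¹ * x * g) (by simpa using (pCore_normal q).conj_mem x hx g⁻¹)
    calc x * (g * u * g⁻¹) = g * ((g⁻¹ * x * g) * u) * g⁻¹ := by group
      _ = g * u * g⁻¹ * x := by rw [h1]; group

theorem exists_mem_centerSocle [Finite H] {q : ℕ} (hq : q.Prime) (h : pCore q H ≠ ⊥) :
    ∃ a ∈ centerSocle q H, a ≠ 1 := by
  have := Fact.mk hq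
  have hnt : Nontrivial (pCore q H) := (Subgroup.nontrivial_iff_ne_bot _).2 h
  have h1 : Nontrivial (Subgroup.center (pCore q H)) := (pCore_isPGroup q).center_nontrivial
  obtain ⟨n, hn, hcard⟩ :=
    ((pCore_isPGroup (G := H) q).to_subgroup (Subgroup.center _)).nontrivial_iff_card.1 h1
  obtain ⟨⟨⟨a, ha⟩, hac⟩, hao⟩ := exists_prime_orderOf_dvd_card' (G := Subgroup.center (pCore q H)) q
    (by rw [hcard]; exact dvd_pow_self q hn.ne')
  rw [Subgroup.orderOf_mk, Subgroup.orderOf_mk] at hao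
  refine ⟨a, ⟨ha, fun x hx => ?_, hao ▸ pow_orderOf_eq_one a⟩, ?_⟩
  · exact congrArg Subtype.val (Subgroup.mem_center_iff.1 hac ⟨x, hx⟩)
  · rintro rfl
    rw [orderOf_one] at hao
    exact hq.one_lt.ne hao

theorem mem_zpowers_symm {p : ℕ} (hp : p.Prime) {b s : H} (hb : b ^ p = 1) (hs : s ≠ 1)
    (h : s ∈ Subgroup.zpowers b) : b ∈ Subgroup.zpowers s := by
  obtain ⟨k, rfl⟩ := h
  have hk : ¬ (p : ℤ) ∣ k := by
    rintro ⟨c, rfl⟩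
    refine hs ?_
    change b ^ ((p : ℤ) * c) = 1
    rw [zpow_mul, zpow_natCast, hb, one_zpow]
  have hcop : IsCoprime k (p : ℤ) :=
    ((Nat.prime_iff_prime_int.1 hp).irreducible.coprime_iff_not_dvd.2 hk).symm
  obtain ⟨u, v, huv⟩ := hcop
  refine ⟨u, ?_⟩
  change (b ^ k) ^ u = b
  calc (b ^ k) ^ u = b ^ (u * k + v * p) := by
        rw [zpow_add, mul_comm v, zpow_mul b p v, zpow_natCast, hb, one_zpow, mul_one, mul_comm u,
          zpow_mul]
    _ = b := by rw [huv, zpow_one]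

/-- Commuting elements `b ≠ 1` and `s` of order `p` generate the same group, provided that some
element `a ≠ 1` commutes with them and with `y`. -/
theorem mem_zpowers (h : FixedPointFreeConfig X y) {p : ℕ} (hp : p.Prime) {a b s : H}
    (ha : a ≠ 1) (hay : Commute a y) (hba : Commute b a) (hsa : Commute s a) (hb : b ≠ 1)
    (hbp : b ^ p = 1) (hsp : s ^ p = 1) (hbs : Commute b s) : s ∈ Subgroup.zpowers b :=
  h.mem_zpowers_of_commute p hp b s hbp hsp hb hbs fun i j hij =>
    h.mem_of_commute ha hay hij ((hba.pow_left i).mul_left (hsa.pow_left j))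

variable [Finite H]

/-- If `q` divides the order of `y` and `O_q(H) ≠ 1`, then the powers of `y` of order `q` generate a
normal subgroup. -/
theorem not_dvd_orderOf (h : FixedPointFreeConfig X y) (hX : ¬ ∀ x ≠ 1, x ∈ X) {q : ℕ}
    (hq : q.Prime) (hQ : pCore q H ≠ ⊥) : ¬ q ∣ orderOf y := by
  have := Fact.mk hq
  intro hqy
  obtain ⟨m, hb1, hbq⟩ := exists_prime_pow hq hqy
  set b := y ^ m
  have hby : Commute b y := (Commute.refl y).pow_left m
  obtain ⟨a, ha, ha1⟩ := exists_mem_centerSocle hq hQ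
  have hpg : IsPGroup q (centerSocle q H) := (pCore_isPGroup q).to_le fun v hv => hv.1
  -- `b` fixes an element of the socle
  obtain ⟨v, hv, hvb, hv1⟩ : ∃ v ∈ centerSocle q H, v * b = b * v ∧ v ≠ 1 := by
    by_contra! hno
    have h1 := FixedPointFree.not_dvd_card (N := centerSocle q H) (k := 1) hq (by rwa [pow_one]) hno
    rcases hpg.card_eq_or_dvd with h2 | h2
    · exact ha1 (Subgroup.mem_bot.1 (Subgroup.card_eq_one.1 h2 ▸ ha))
    · exact h1 h2
  have hvz : v ∈ Subgroup.zpowers b :=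
    h.mem_zpowers hq hb1 hby (Commute.refl b) hvb hb1 hbq hv.2.2 (show Commute v b from hvb).symm
  have hbS : b ∈ centerSocle q H :=
    Subgroup.zpowers_le.2 hv (mem_zpowers_symm hq hbq hv1 hvz)
  refine hX (h.forall_mem_of_normal hb1 hby fun x => ?_)
  have hx : x⁻¹ * b * x ∈ centerSocle q H := by
    simpa using (centerSocle_normal q).conj_mem b hbS x⁻¹
  have hxb : Commute (x⁻¹ * b * x) b := hbS.2.1 _ hx.1
  exact h.mem_zpowers hq hb1 hby (Commute.refl b) hxb hb1 hbq hx.2.2 hxb.symm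

/-- Some prime divisor of `q - 1` divides the order of `y`, unless all non-trivial elements lie in
`X`: the socle of `Z(O_q(H))` has order `q`, and `y` does not centralise it. -/
theorem exists_prime_dvd (h : FixedPointFreeConfig X y) (hX : ¬ ∀ x ≠ 1, x ∈ X) {q : ℕ}
    (hq : q.Prime) (hQ : pCore q H ≠ ⊥) : ∃ p : ℕ, p.Prime ∧ p ∣ q - 1 ∧ p ∣ orderOf y := by
  obtain ⟨a, ha, ha1⟩ := exists_mem_centerSocle hq hQ
  obtain ⟨p, hp, hpy⟩ := Nat.exists_prime_and_dvd (n := orderOf y) (by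
    rw [Ne, orderOf_eq_one_iff]; exact h.ne_one)
  have hpq : p ≠ q := by
    rintro rfl
    exact h.not_dvd_orderOf hX hq hQ hpy
  obtain ⟨m, hb1, hbp⟩ := exists_prime_pow hp hpy
  set b := y ^ m
  have hby : Commute b y := (Commute.refl y).pow_left m
  have hbX : b ∈ X := h.mem_of_commute hb1 hby hb1 (Commute.refl b)
  have hSb : ∀ v ∈ centerSocle q H, Commute v b := fun v hv =>
    h.commute_of_abelian hp hq hpq hbX hbp hb1 (R := centerSocle q H) (fun v hv => hv.1)
      (fun r hr => (centerSocle_normal q).conj_mem r hr b) (fun r hr s hs => hs.2.1 r hr.1) hv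
  have hSa : ∀ v ∈ centerSocle q H, v ∈ Subgroup.zpowers a := fun v hv =>
    h.mem_zpowers hq hb1 hby (hSb a ha) (hSb v hv) ha1 ha.2.2 hv.2.2 (hv.2.1 a ha.1)
  have hay : ¬ Commute a y := fun hay => hX (h.forall_mem_of_normal ha1 hay fun x =>
    hSa _ (by simpa using (centerSocle_normal q).conj_mem a ha x⁻¹))
  -- `y ^ (q - 1)` centralises the group `⟨a⟩` of order `q`
  obtain ⟨k, hk⟩ := hSa _ ((centerSocle_normal q).conj_mem a ha y)
  have hk : a ^ k = y * a * y⁻¹ := hk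
  have hkt : ∀ t : ℕ, a ^ (k ^ t) = y ^ t * a * (y ^ t)⁻¹ := by
    intro t
    induction t with
    | zero => simp
    | succ t ih =>
      rw [pow_succ, zpow_mul, ih, conj_zpow, hk, pow_succ]; group
  have hqk : ¬ (q : ℤ) ∣ k := by
    rintro ⟨c, rfl⟩
    rw [zpow_mul, zpow_natCast, ha.2.2, one_zpow] at hk
    exact ha1 (by rw [eq_comm, mul_inv_eq_one, mul_eq_left] at hk; exact hk)
  have hfermat : (q : ℤ) ∣ k ^ (q - 1) - 1 := by
    have := Fact.mk hq
    have h1 : (k : ZMod q) ≠ 0 := by rwa [Ne, ZMod.intCast_zmod_eq_zero_iff_dvd]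
    have h2 := ZMod.pow_card_sub_one_eq_one h1
    rw [← ZMod.intCast_zmod_eq_zero_iff_dvd]
    push_cast
    rw [h2, sub_self]
  have hcq : Commute a (y ^ (q - 1)) := by
    obtain ⟨c, hc⟩ := hfermat
    have h1 : a ^ (k ^ (q - 1)) = a := by
      rw [show k ^ (q - 1) = q * c + 1 by linarith, zpow_add_one, zpow_mul, zpow_natCast, ha.2.2,
        one_zpow, one_mul]
    rw [hkt] at h1
    exact (mul_inv_eq_iff_eq_mul.1 h1).symm
  by_contra! hno
  have hcop : (q - 1).Coprime (orderOf y) := Nat.coprime_of_dvd hno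
  have h1 : Commute a (y ^ (Nat.gcd (q - 1) (orderOf y))) := by
    rw [← zpow_natCast, Nat.gcd_eq_gcd_ab, zpow_add, zpow_mul, zpow_mul, zpow_natCast,
      zpow_natCast, pow_orderOf_eq_one, one_zpow, mul_one]
    exact hcq.zpow_right _
  rw [hcop.gcd_eq_one, pow_one] at h1
  exact hay h1

/-- If `p ∣ q - 1`, then an element of `X` of order `p` centralises `O_q(H)`: a minimal subgroup of
`O_q(H)` that it normalises but does not centralise would be cyclic. -/
theorem commute_of_dvd_sub_one (h : FixedPointFreeConfig X y) {p q : ℕ} (hp : p.Prime)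
    (hq : q.Prime) (hpq : p ∣ q - 1) {b : H} (hbX : b ∈ X) (hbp : b ^ p = 1) (hb : b ≠ 1) {x : H}
    (hx : x ∈ pCore q H) : x * b = b * x := by
  have hne : p ≠ q := by
    rintro rfl
    exact absurd (Nat.le_of_dvd (by have := hp.two_le; omega) hpq) (by have := hp.pos; omega)
  by_contra hxb
  let 𝒮 : Set (Subgroup H) := {R | R ≤ pCore q H ∧ b ∈ Subgroup.normalizer (R : Set H) ∧
    ∃ r ∈ R, r * b ≠ b * r}
  have h𝒮 : 𝒮.Nonempty := ⟨pCore q H, le_rfl, by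
    rw [Subgroup.normalizer_eq_top_iff.2 (pCore_normal q)]; trivial, x, hx, hxb⟩
  obtain ⟨R, ⟨hRQ, hRn, r, hr, hrb⟩, hmin⟩ := (Set.toFinite 𝒮).exists_minimal h𝒮
  have hRn' := Subgroup.mem_normalizer_iff.1 hRn
  have hRq : IsPGroup q R := (pCore_isPGroup q).to_le hRQ
  let φ : MulAut R := R.normalizerMonoidHom ⟨b, hRn⟩
  have hφ : ∀ s : R, (φ s : H) = b * s * b⁻¹ := fun _ => rfl
  have hcyc : IsCyclic R := by
    refine isCyclic_of_minimal_action hp hq hpq hRq φ ?_ ?_ fun S hS hSt s hs => ?_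
    · rw [← map_pow, show (⟨b, hRn⟩ : Subgroup.normalizer (R : Set H)) ^ p = 1 from
        Subtype.ext hbp, map_one]
    · intro h1
      have h2 := hφ ⟨r, hr⟩
      rw [h1] at h2
      exact hrb (eq_mul_inv_iff_mul_eq.1 h2)
    · -- a proper invariant subgroup is centralised by minimality
      by_contra hsb
      have hSR : S.map R.subtype ≤ R := Subgroup.map_subtype_le S
      have hmem : S.map R.subtype ∈ 𝒮 := by
        refine ⟨hSR.trans hRQ, ?_, s, ⟨s, hs, rfl⟩, fun h1 => hsb (Subtype.ext ?_)⟩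
        · rw [Subgroup.mem_normalizer_iff_map_conj_eq]
          refine Subgroup.eq_of_le_of_card_ge ?_ (Subgroup.card_map_of_injective
            (MulEquiv.injective (MulAut.conj b))).ge
          rintro _ ⟨_, ⟨t, ht, rfl⟩, rfl⟩
          exact ⟨φ t, hS t ht, rfl⟩
        · rw [hφ, ← h1, mul_inv_cancel_right]
      refine hSt ((Subgroup.eq_top_iff' S).2 fun t => ?_)
      obtain ⟨t', ht', h1⟩ := hmin hmem hSR t.2
      exact (Subtype.ext h1 : t' = t) ▸ ht'
  refine hrb (h.commute_of_abelian hp hq hne hbX hbp hb hRQ (fun s hs => (hRn' s).1 hs)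
    (fun s hs t ht => ?_) hr)
  let _ := hcyc.commGroup
  exact congrArg Subtype.val (mul_comm (⟨s, hs⟩ : R) ⟨t, ht⟩)

/-- The elements of prime order of `⟨y⟩` centralise `O_q(H)`. First, some element of order `p ∣ q - 1`
does. Hence `O_q(H) ⊆ X ∪ {1}`, so `O_q(H)` is cyclic as `q` is odd, and all the others follow. -/
theorem commute_pCore (h : FixedPointFreeConfig X y) (hX : ¬ ∀ x ≠ 1, x ∈ X) {p q : ℕ}
    (hp : p.Prime) (hq : q.Prime) {m : ℕ} (hb1 : y ^ m ≠ 1) (hbp : (y ^ m) ^ p = 1) {x : H}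
    (hx : x ∈ pCore q H) : x * y ^ m = y ^ m * x := by
  have := Fact.mk hq
  by_cases hQ : pCore q H = ⊥
  · rw [hQ, Subgroup.mem_bot] at hx
    rw [hx, one_mul, mul_one]
  have hpow : ∀ n : ℕ, y ^ n ≠ 1 → y ^ n ∈ X := fun n hn =>
    h.mem_of_commute hn ((Commute.refl y).pow_left n) hn (Commute.refl _)
  obtain ⟨p₀, hp₀, hp₀q, hp₀y⟩ := h.exists_prime_dvd hX hq hQ
  obtain ⟨m₀, hc1, hcp⟩ := exists_prime_pow hp₀ hp₀y
  have hQc : ∀ v ∈ pCore q H, Commute v (y ^ m₀) := fun v hv =>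
    h.commute_of_dvd_sub_one hp₀ hq hp₀q (hpow _ hc1) hcp hc1 hv
  have hcy : Commute (y ^ m₀) y := (Commute.refl y).pow_left m₀
  have hodd : Odd q := hq.odd_of_ne_two (by
    rintro rfl
    exact hp₀.one_lt.ne' (Nat.dvd_one.1 hp₀q))
  obtain ⟨a, ha, ha1⟩ := exists_mem_centerSocle hq hQ
  have hcyc : IsCyclic (pCore q H) := by
    obtain ⟨n, hn⟩ := (IsPGroup.iff_card (p := q)).1 (pCore_isPGroup (G := H) q)
    refine isCyclic_of_forall_mem_zpowers hq hodd n hn fun s v hs hv hv1 => ?_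
    have key : ∀ u ∈ pCore q H, u ^ q = 1 → u ∈ Subgroup.zpowers a := fun u hu huq =>
      h.mem_zpowers hq hc1 hcy (hQc a ha.1) (hQc u hu) ha1 ha.2.2 huq (ha.2.1 u hu).symm
    have hv' : (v : H) ^ q = 1 := by simpa using congrArg Subtype.val hv
    have h1 := mem_zpowers_symm hq ha.2.2 (by simpa using hv1) (key v v.2 hv')
    have h2 := Subgroup.zpowers_le.2 h1 (key s s.2 (by simpa using congrArg Subtype.val hs))
    obtain ⟨k, hk⟩ := h2
    exact ⟨k, Subtype.ext (by simpa using hk)⟩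
  have hpq : p ≠ q := by
    rintro rfl
    refine h.not_dvd_orderOf hX hq hQ ?_
    have h1 : orderOf (y ^ m) = p := orderOf_eq_prime hbp hb1
    exact h1 ▸ orderOf_pow_dvd m
  refine h.commute_of_abelian hp hq hpq (hpow m hb1) hbp hb1 le_rfl
    (fun r hr => (pCore_normal q).conj_mem r hr _) (fun r hr s hs => ?_) hx
  let _ := hcyc.commGroup
  exact congrArg Subtype.val (mul_comm (⟨r, hr⟩ : pCore q H) ⟨s, hs⟩)

/-- In a `FixedPointFreeConfig` all non-trivial elements lie in `X`. Otherwise an element `b` of prime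
order `p` of `⟨y⟩` centralises all cores and therefore lies in `O_p(H)`, but `p` divides the order
of `y`. -/
theorem forall_mem [Group.IsSolvable H] (h : FixedPointFreeConfig X y) : ∀ x ≠ 1, x ∈ X := by
  by_contra hX
  obtain ⟨p, hp, hpy⟩ := Nat.exists_prime_and_dvd (n := orderOf y) (by
    rw [Ne, orderOf_eq_one_iff]; exact h.ne_one)
  obtain ⟨m, hb1, hbp⟩ := exists_prime_pow hp hpy
  have h1 : y ^ m ∈ pCore p H :=
    mem_pCore_of_centralizes hp hbp fun q hq x hx => h.commute_pCore hX hp hq hb1 hbp hx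
  refine h.not_dvd_orderOf hX hp (fun h2 => hb1 ?_) hpy
  rw [h2] at h1
  exact h1

end FixedPointFreeConfig

end Core

/-! ### Short walks in the Engel graph -/

section FittingAction

variable {G : Type*} [Group G]

/-- The elements of `G / F(G)` that act without fixed points on the Fitting subgroup `F(G)`. -/
def fixedPointFreeSet (G : Type*) [Group G] : Set (G ⧸ fitting G) :=
  {h | ∀ g : G, (g : G ⧸ fitting G) = h → FixedPointFree (fitting G) g}

theorem FixedPointFree.pow_eq_one {g : G} {p : ℕ} (h : FixedPointFree (fitting G) g)
    (hg : (g : G ⧸ fitting G) ^ p = 1) : g ^ p = 1 :=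
  h _ ((QuotientGroup.eq_one_iff _).1 hg) ((Commute.refl g).pow_left p).eq

variable [Finite G]

theorem mk_mem_fixedPointFreeSet {g : G} (h : FixedPointFree (fitting G) g) :
    (g : G ⧸ fitting G) ∈ fixedPointFreeSet G := by
  intro g' hg'
  have h1 : g⁻¹ * g' ∈ fitting G := QuotientGroup.eq.1 hg'.symm
  have h2 : g * (g⁻¹ * g') * g⁻¹ ∈ fitting G := (fitting_normal).conj_mem _ h1 g
  have h3 := h.mul_left h2
  convert h3 using 1
  group

theorem exists_center_fitting_ne_one [Group.IsSolvable G] [Nontrivial G] :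
    ∃ z ∈ fitting G, z ≠ 1 ∧ ∀ x ∈ fitting G, x * z = z * x := by
  have h1 : Nontrivial (fitting G) := (Subgroup.nontrivial_iff_ne_bot _).2 fitting_ne_bot
  have h2 : Group.IsNilpotent (fitting G) := fitting_nilpotent
  obtain ⟨⟨⟨z, hz⟩, hzc⟩, hz1⟩ := Subgroup.ne_bot_iff_exists_ne_one.1
    (Group.IsNilpotent.center_ne_bot (fitting G))
  refine ⟨z, hz, fun h => hz1 (Subtype.ext (Subtype.ext h)), fun x hx => ?_⟩
  exact congrArg Subtype.val (Subgroup.mem_center_iff.1 hzc ⟨x, hx⟩)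

/-- If `M` maps onto a `q`-subgroup of `G / N`, then so does each of its Sylow `q`-subgroups. -/
theorem exists_mem_sylow_mk_eq {N M : Subgroup G} [N.Normal] {q : ℕ} (hq : q.Prime)
    (hM : IsPGroup q (M.map (QuotientGroup.mk' N))) (S : Sylow q M) {g : G} (hg : g ∈ M) :
    ∃ s : M, s ∈ S ∧ (s : G)⁻¹ * g ∈ N := by
  have := Fact.mk hq
  let f := (QuotientGroup.mk' N).subgroupMap M
  have hf : Function.Surjective f := (QuotientGroup.mk' N).subgroupMap_surjective M
  have h1 : (⊤ : Subgroup (M.map (QuotientGroup.mk' N))) = S.mapSurjective hf :=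
    (S.mapSurjective hf).3 (hM.to_subgroup ⊤) le_top
  have h2 : f ⟨g, hg⟩ ∈ (S.mapSurjective hf : Subgroup _) := h1 ▸ Subgroup.mem_top _
  obtain ⟨s, hs, h3⟩ := h2
  exact ⟨s, hs, QuotientGroup.eq.1 (congrArg Subtype.val h3)⟩

/-- The subgroup `O_q(G / F(G))` acts faithfully on the `q'`-part of the Fitting subgroup `F(G)`. -/
theorem mem_fitting_of_centralizes {q : ℕ} (hq : q.Prime) {g : G}
    (hg : (g : G ⧸ fitting G) ∈ pCore q (G ⧸ fitting G))
    (hc : ∀ l : ℕ, l.Prime → l ≠ q → ∀ z ∈ pCore l G, g * z = z * g) : g ∈ fitting G := by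
  have := Fact.mk hq
  let C : Subgroup G := ⨅ l : {l : ℕ // l.Prime ∧ l ≠ q}, Subgroup.centralizer (pCore l.1 G : Set G)
  have hC : ∀ x, x ∈ C ↔ ∀ l : ℕ, l.Prime → l ≠ q → ∀ z ∈ pCore l G, z * x = x * z := by
    intro x
    simp [C, Subgroup.mem_iInf, Subgroup.mem_centralizer_iff]
  have hCn : C.Normal := Subgroup.normal_iInf_normal fun l => inferInstance
  let M : Subgroup G := C ⊓ (pCore q (G ⧸ fitting G)).comap (QuotientGroup.mk' (fitting G))
  have hMn : M.Normal := inferInstance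
  have hgM : g ∈ M := ⟨(hC g).2 fun l hl hlq z hz => (hc l hl hlq z hz).symm, hg⟩
  have hMq : IsPGroup q (M.map (QuotientGroup.mk' (fitting G))) :=
    (pCore_isPGroup q).to_le (Subgroup.map_le_iff_le_comap.2 inf_le_right)
  obtain ⟨S⟩ : Nonempty (Sylow q M) := inferInstance
  -- the Sylow `q`-subgroup of `M` is normal, since `M ∩ F(G)` normalises it
  have hSn : (S : Subgroup M).Normal := by
    rw [← Subgroup.normalizer_eq_top_iff, Subgroup.eq_top_iff']
    intro x
    obtain ⟨s, hs, hsx⟩ := exists_mem_sylow_mk_eq hq hMq S x.2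
    have h1 : s⁻¹ * x ∈ Subgroup.normalizer ((S : Subgroup M) : Set M) := by
      refine mem_of_primary_powers_mem _ (isOfFinOrder_of_finite _) fun l hl n k h => ?_
      have h2 : (((s⁻¹ * x) ^ n : M) : G) ∈ pCore l G :=
        mem_pCore_of_mem_fitting (k := k) hl (by
          simpa using (fitting G).pow_mem hsx n) (by simpa using congrArg Subtype.val h)
      by_cases hlq : l = q
      · subst hlq
        have h3 : IsPGroup l ((pCore l G).subgroupOf M) := (pCore_isPGroup l).comap_subtype
        exact Subgroup.le_normalizer (h3.le_sylow_of_normal S h2)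
      · rw [Subgroup.mem_normalizer_iff]
        intro t
        have h3 : (s⁻¹ * x) ^ n * t = t * (s⁻¹ * x) ^ n :=
          Subtype.ext ((hC t).1 t.2.1 l hl hlq _ h2)
        rw [h3, mul_inv_cancel_right]
    have h2 := (Subgroup.normalizer ((S : Subgroup M) : Set M)).mul_mem
      (Subgroup.le_normalizer hs) h1
    rwa [mul_inv_cancel_left] at h2
  have hSc : (S : Subgroup M).Characteristic := S.characteristic_of_normal hSn
  have hSF : (S : Subgroup M).map M.subtype ≤ fitting G :=
    (le_pCore inferInstance (S.isPGroup'.map _)).trans (pCore_le_fitting hq)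
  obtain ⟨s, hs, hsg⟩ := exists_mem_sylow_mk_eq hq hMq S hgM
  have h1 : (s : G) ∈ fitting G := hSF ⟨s, hs, rfl⟩
  have h2 := (fitting G).mul_mem h1 hsg
  rwa [mul_inv_cancel_left] at h2

/-- A lift `b₁` of an element of prime order `p` that normalises a Sylow `q`-subgroup of the preimage
of a `q`-subgroup `R`. -/
theorem exists_conj_normalizing_sylow {p q : ℕ} (hq : q.Prime) {b₀ : G}
    (hb₀p : b₀ ^ p = 1) (hb₀ : FixedPointFree (fitting G) b₀) {R : Subgroup (G ⧸ fitting G)}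
    (hR : IsPGroup q R) (hbR : ∀ r ∈ R, (b₀ : G ⧸ fitting G) * r * (b₀ : G ⧸ fitting G)⁻¹ ∈ R) :
    ∃ (b₁ : G) (T : Subgroup G), b₁ ^ p = 1 ∧ FixedPointFree (fitting G) b₁ ∧
      (b₁ : G ⧸ fitting G) = b₀ ∧ IsPGroup q T ∧ (∀ t ∈ T, b₁ * t * b₁⁻¹ ∈ T) ∧
      T.map (QuotientGroup.mk' (fitting G)) = R := by
  have := Fact.mk hq
  set F := fitting G with hF
  let π := QuotientGroup.mk' F
  let M : Subgroup G := R.comap π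
  have hMR : M.map π = R := Subgroup.map_comap_eq_self_of_surjective (QuotientGroup.mk'_surjective F) R
  have hMq : IsPGroup q (M.map π) := by rwa [hMR]
  have hbM : b₀ ∈ Subgroup.normalizer (M : Set G) := by
    rw [Subgroup.mem_normalizer_iff_map_conj_eq]
    refine Subgroup.eq_of_le_of_card_ge ?_ (Subgroup.card_map_of_injective
      (MulEquiv.injective (MulAut.conj b₀))).ge
    rintro _ ⟨x, hx, rfl⟩
    exact hbR _ hx
  let φ : MulAut M := M.normalizerMonoidHom ⟨b₀, hbM⟩
  obtain ⟨S⟩ : Nonempty (Sylow q M) := inferInstance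
  -- `b₀` and some element of `F` conjugate `S` to the same Sylow subgroup
  obtain ⟨g, hg⟩ := MulAction.exists_smul_eq M S (φ • S)
  obtain ⟨s, hs, hsg⟩ := exists_mem_sylow_mk_eq hq hMq S g.2
  have hf : (g : G) * (s : G)⁻¹ ∈ F := by
    have := (fitting_normal).conj_mem _ hsg s
    convert this using 1
    group
  set f := (g : G) * (s : G)⁻¹ with hfdef
  have hbf : ∀ t ∈ S, ∃ t' ∈ S, (f⁻¹ * b₀) * (t : G) * (f⁻¹ * b₀)⁻¹ = ((t' : M) : G) := by
    intro t ht
    have h1 : φ t ∈ φ • S := ⟨t, ht, rfl⟩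
    rw [← hg] at h1
    obtain ⟨u, hu, hut⟩ := h1
    have h2 : (g : G) * u * (g : G)⁻¹ = b₀ * t * b₀⁻¹ := congrArg Subtype.val hut
    refine ⟨s * u * s⁻¹, mul_mem (mul_mem hs hu) (inv_mem hs), ?_⟩
    calc (f⁻¹ * b₀) * (t : G) * (f⁻¹ * b₀)⁻¹ = f⁻¹ * (b₀ * t * b₀⁻¹) * f := by group
      _ = _ := by rw [← h2, hfdef]; push_cast; group
  obtain ⟨m, hm, hmb⟩ := hb₀.exists_conj (F.inv_mem hf)
  refine ⟨m * b₀ * m⁻¹, (S : Subgroup M).map M.subtype, ?_, hb₀.conj m, ?_, S.isPGroup'.map _, ?_, ?_⟩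
  · rw [conj_pow, hb₀p]; group
  · rw [hmb]
    change π (f⁻¹ * b₀) = π b₀
    have h1 : π f⁻¹ = 1 := (QuotientGroup.eq_one_iff (N := F) f⁻¹).2 (F.inv_mem hf)
    rw [map_mul, h1, one_mul]
  · rintro _ ⟨t, ht, rfl⟩
    obtain ⟨t', ht', h1⟩ := hbf t ht
    rw [hmb]
    exact ⟨t', ht', h1.symm⟩
  · refine le_antisymm ?_ ?_
    · rintro _ ⟨_, ⟨t, -, rfl⟩, rfl⟩
      exact t.2
    · intro r hr
      obtain ⟨x, rfl⟩ := QuotientGroup.mk'_surjective F r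
      obtain ⟨s, hs, hsx⟩ := exists_mem_sylow_mk_eq hq hMq S (g := x) hr
      exact ⟨s, ⟨s, hs, rfl⟩, QuotientGroup.eq.2 hsx⟩

/-- There is no Frobenius group `R ⋊ ⟨b⟩` with `R ≤ O_q(G / F(G))` and `b` of prime order acting
without fixed points on `F(G)`: lifted to `G`, the group `R` would centralise all `O_l(G)` with
`l ≠ q`. -/
theorem eq_bot_of_mem_fixedPointFreeSet {p q : ℕ} (hp : p.Prime) (hq : q.Prime)
    {b : G ⧸ fitting G} (hbX : b ∈ fixedPointFreeSet G) (hbp : b ^ p = 1)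
    {R : Subgroup (G ⧸ fitting G)} (hRq : R ≤ pCore q (G ⧸ fitting G))
    (hbR : ∀ r ∈ R, b * r * b⁻¹ ∈ R) (hR : FixedPointFree R b) : R = ⊥ := by
  have := Fact.mk hq
  obtain ⟨b₀, rfl⟩ := QuotientGroup.mk_surjective b
  have hb₀ := hbX b₀ rfl
  obtain ⟨b₁, T, hb₁p, hb₁, hb₁₀, hTq, hbT, hTR⟩ :=
    exists_conj_normalizing_sylow hq (hb₀.pow_eq_one hbp) hb₀ ((pCore_isPGroup q).to_le hRq) hbR
  have hTb : FixedPointFree T b₁ := by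
    intro t ht htb
    have h1 : (t : G ⧸ fitting G) = 1 := by
      refine hR _ (hTR ▸ ⟨t, ht, rfl⟩) ?_
      rw [← hb₁₀]
      exact congrArg (QuotientGroup.mk' (fitting G)) htb
    exact hb₁ t ((QuotientGroup.eq_one_iff t).1 h1) htb
  have hTF : T ≤ fitting G := by
    intro t ht
    have htR : (t : G ⧸ fitting G) ∈ R := hTR ▸ ⟨t, ht, rfl⟩
    refine mem_fitting_of_centralizes hq (hRq htR) fun l hl hlq z hz => ?_
    have := Fact.mk hl
    exact FixedPointFree.commute_of_coprime _ (pCore_normal l) (pCore_isPGroup l).isNilpotent hp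
      hb₁p hbT hTb (hb₁.mono (pCore_le_fitting hl))
      (IsPGroup.coprime_card_of_ne q l hlq.symm _ _ hTq (pCore_isPGroup l)) le_rfl ht hz
  rw [← hTR, eq_bot_iff]
  rintro _ ⟨t, ht, rfl⟩
  exact (QuotientGroup.eq_one_iff t).2 (hTF ht)

open scoped IsMulCommutative in
/-- An elementary abelian group of rank two in `G / F(G)` does not act without fixed points on the
center of `F(G)`. -/
theorem mem_zpowers_of_mem_fixedPointFreeSet [Group.IsSolvable G] [Nontrivial G] {p : ℕ}
    (hp : p.Prime) {b s : G ⧸ fitting G} (hbp : b ^ p = 1) (hsp : s ^ p = 1) (hb : b ≠ 1)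
    (hbs : Commute b s)
    (hX : ∀ i j : ℕ, b ^ i * s ^ j ≠ 1 → b ^ i * s ^ j ∈ fixedPointFreeSet G) :
    s ∈ Subgroup.zpowers b := by
  by_contra hsb
  obtain ⟨b₀, rfl⟩ := QuotientGroup.mk_surjective b
  obtain ⟨s₀, rfl⟩ := QuotientGroup.mk_surjective s
  let π := QuotientGroup.mk' (fitting G)
  let Z : Subgroup G := (Subgroup.center (fitting G)).map (fitting G).subtype
  have hZF : Z ≤ fitting G := Subgroup.map_subtype_le _
  let ρ := conjEnd Z
  -- the action on `Z` only depends on the coset modulo the Fitting subgroup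
  have hρ : ∀ g h : G, π g = π h → ρ g = ρ h := by
    intro g h hgh
    have h1 : g⁻¹ * h ∈ fitting G := QuotientGroup.eq.1 hgh
    have h2 : ρ (g⁻¹ * h) = 1 := by
      ext v
      obtain ⟨z, hz, hzv⟩ := v.toMul.2
      have h3 := congrArg Subtype.val (Subgroup.mem_center_iff.1 hz ⟨_, h1⟩)
      change (g⁻¹ * h) * (v.toMul : G) * (g⁻¹ * h)⁻¹ = v.toMul
      rw [← hzv]
      exact mul_inv_eq_iff_eq_mul.2 h3
    rw [map_mul] at h2
    calc ρ g = ρ g * (ρ g⁻¹ * ρ h) := by rw [h2, mul_one]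
      _ = ρ h := by rw [← mul_assoc, ← map_mul, mul_inv_cancel, map_one, one_mul]
  have hfix : ∀ i j : ℕ, π b₀ ^ i * π s₀ ^ j ≠ 1 →
      ∀ v, (ρ b₀ ^ i * ρ s₀ ^ j) v = v → v = 0 := by
    intro i j hij v hv
    have h1 : FixedPointFree (fitting G) (b₀ ^ i * s₀ ^ j) :=
      hX i j hij _ (by simp)
    refine (h1.mono hZF).conjEnd v ?_
    change ρ (b₀ ^ i * s₀ ^ j) v = v
    rwa [map_mul, map_pow, map_pow]
  have hb₀ : FixedPointFree (fitting G) b₀ := by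
    have := hX 1 0 (by simpa using hb) b₀ (by simp)
    exact this
  have hnd : ¬ p ∣ Nat.card Z := (hb₀.mono hZF).not_dvd_card (k := 1) hp (by
    rw [pow_one]; exact hb₀.pow_eq_one hbp)
  have key := nsmul_eq_zero_of_fixedPointFree (b := ρ b₀) (s := ρ s₀) hp
    (by
      change ρ b₀ * ρ s₀ = ρ s₀ * ρ b₀
      rw [← map_mul, ← map_mul]
      exact hρ _ _ (by rw [map_mul, map_mul]; exact hbs))
    (by rw [← map_pow, ← map_one ρ]; exact hρ _ _ (by rw [map_pow, map_one]; exact hbp))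
    (by rw [← map_pow, ← map_one ρ]; exact hρ _ _ (by rw [map_pow, map_one]; exact hsp))
    (by
      intro i hi v hv
      refine hfix i 0 (fun h => hi ?_) v (by simpa using hv)
      rw [pow_zero, mul_one] at h
      have h1 : orderOf (π b₀) = p := by
        have := Fact.mk hp
        exact orderOf_eq_prime hbp hb
      exact h1 ▸ orderOf_dvd_of_pow_eq_one h)
    (by
      intro j v hv
      refine hfix j 1 (fun h => hsb ?_) v (by simpa using hv)
      rw [pow_one] at h
      have h1 : π s₀ = (π b₀ ^ j)⁻¹ := (inv_eq_of_mul_eq_one_right h).symm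
      change π s₀ ∈ _
      rw [h1]
      exact inv_mem (pow_mem (Subgroup.mem_zpowers _) j))
  obtain ⟨z, hz, hz1, hzc⟩ := exists_center_fitting_ne_one (G := G)
  have hzZ : z ∈ Z := ⟨⟨z, hz⟩, Subgroup.mem_center_iff.2 fun x => Subtype.ext (hzc x x.2), rfl⟩
  have h1 : (⟨z, hzZ⟩ : Z) ^ p = 1 := congrArg Additive.toMul (key (Additive.ofMul ⟨z, hzZ⟩))
  have h2 : orderOf (⟨z, hzZ⟩ : Z) = p := by
    have := Fact.mk hp
    exact orderOf_eq_prime h1 fun h => hz1 (congrArg Subtype.val h)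
  exact hnd (h2 ▸ orderOf_dvd_natCard _)

/-- If no element at Engel distance at most two from `y` has a non-trivial fixed point on the Fitting
subgroup, then all elements outside of the Fitting subgroup act without fixed points. -/
theorem fixedPointFree_of_forall_engelRel [Group.IsSolvable G] {y : G} (hy : y ≠ 1)
    (hT : ∀ a u : G, a ≠ 1 → u ≠ 1 → EngelRel a u → EngelRel u y → FixedPointFree (fitting G) a)
    {g : G} (hg : g ∉ fitting G) : FixedPointFree (fitting G) g := by
  have hnt : Nontrivial G := ⟨y, 1, hy⟩
  have hrefl : ∀ x : G, EngelRel x x := fun x => EngelRel.of_commute (Commute.refl x)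
  have hyF : FixedPointFree (fitting G) y := hT y y hy hy (hrefl y) (hrefl y)
  have hcfg : FixedPointFreeConfig (fixedPointFreeSet G) (y : G ⧸ fitting G) :=
    { ne_one := by
        intro h
        obtain ⟨z, hz, hz1, hzc⟩ := exists_center_fitting_ne_one (G := G)
        exact hz1 (hyF z hz (hzc y ((QuotientGroup.eq_one_iff y).1 h)).symm)
      mem_of_normalizes := by
        intro a x ha hay hx hxa
        obtain ⟨a₀, rfl⟩ := QuotientGroup.mk_surjective a
        obtain ⟨x₀, rfl⟩ := QuotientGroup.mk_surjective x
        -- a lift of `a` that commutes with `y`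
        have h1 : a₀ * y * a₀⁻¹ * y⁻¹ ∈ fitting G := by
          rw [← QuotientGroup.eq_one_iff]
          change (a₀ : G ⧸ fitting G) * y * (a₀ : G ⧸ fitting G)⁻¹ * (y : G ⧸ fitting G)⁻¹ = 1
          rw [hay.eq]; group
        obtain ⟨m, hm, hmy⟩ := hyF.exists_conj h1
        rw [inv_mul_cancel_right] at hmy
        obtain ⟨a₁, ha₁⟩ : ∃ a₁, a₁ = m⁻¹ * a₀ := ⟨_, rfl⟩
        have ha₁y : Commute a₁ y := by
          change a₁ * y = y * a₁
          calc a₁ * y = m⁻¹ * (a₀ * y * a₀⁻¹) * a₀ := by rw [ha₁]; group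
            _ = y * a₁ := by rw [← hmy, ha₁]; group
        have ha₁₀ : (a₁ : G ⧸ fitting G) = a₀ := by
          rw [ha₁]
          change ((m⁻¹ : G) : G ⧸ fitting G) * a₀ = a₀
          rw [(QuotientGroup.eq_one_iff _).2 ((fitting G).inv_mem hm), one_mul]
        rw [← ha₁₀] at ha hxa
        -- a lift of `x` that normalises `⟨a₁⟩`
        obtain ⟨k, hk⟩ := hxa
        have hk : (a₁ : G ⧸ fitting G) ^ k = (x₀ : G ⧸ fitting G)⁻¹ * a₁ * x₀ := hk
        have hak : a₁ ^ k ≠ 1 := by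
          intro h
          have h2 : (a₁ : G ⧸ fitting G) ^ k = 1 := by
            rw [← QuotientGroup.mk_zpow, h, QuotientGroup.mk_one]
          rw [hk] at h2
          refine ha ?_
          calc (a₁ : G ⧸ fitting G) = x₀ * ((x₀ : G ⧸ fitting G)⁻¹ * a₁ * x₀) *
                (x₀ : G ⧸ fitting G)⁻¹ := by group
            _ = 1 := by rw [h2]; group
        have hakF : FixedPointFree (fitting G) (a₁ ^ k) :=
          hT _ y hak hy (EngelRel.of_commute (ha₁y.zpow_left k)) (hrefl y)
        have h2 : x₀⁻¹ * a₁ * x₀ * (a₁ ^ k)⁻¹ ∈ fitting G := by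
          rw [← QuotientGroup.eq_one_iff]
          change (x₀ : G ⧸ fitting G)⁻¹ * a₁ * x₀ * ((a₁ ^ k : G) : G ⧸ fitting G)⁻¹ = 1
          rw [QuotientGroup.mk_zpow, hk]; group
        obtain ⟨n, hn, hna⟩ := hakF.exists_conj h2
        rw [inv_mul_cancel_right] at hna
        have h3 : ((x₀ * n : G) : G ⧸ fitting G) = x₀ := by
          rw [QuotientGroup.mk_mul, (QuotientGroup.eq_one_iff _).2 hn, mul_one]
        have h4 : (x₀ * n)⁻¹ * a₁ * (x₀ * n) ∈ Subgroup.zpowers a₁ := by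
          refine ⟨k, ?_⟩
          change a₁ ^ k = _
          calc a₁ ^ k = n⁻¹ * (n * a₁ ^ k * n⁻¹) * n := by group
            _ = _ := by rw [hna]; group
        have h5 : x₀ * n ≠ 1 := fun h => hx (by rw [← h3, h, QuotientGroup.mk_one])
        have h6 : a₁ ≠ 1 := fun h => ha (by rw [h, QuotientGroup.mk_one])
        rw [← h3]
        exact mk_mem_fixedPointFreeSet (hT _ a₁ h5 h6 (EngelRel.of_conj_mem_zpowers h4)
          (EngelRel.of_commute ha₁y))
      eq_bot_of_fixedPointFree := fun p q hp hq _ b hbX hbp _ R hRq hbR hR =>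
        eq_bot_of_mem_fixedPointFreeSet hp hq hbX hbp hRq hbR hR
      mem_zpowers_of_commute := fun p hp b s hbp hsp hb hbs hX =>
        mem_zpowers_of_mem_fixedPointFreeSet hp hbp hsp hb hbs hX }
  exact hcfg.forall_mem (g : G ⧸ fitting G) (fun h => hg ((QuotientGroup.eq_one_iff g).1 h)) g rfl

/-- If all elements outside of the Fitting subgroup act on it without fixed points, then the Fitting
subgroup has a complement by the Schur-Zassenhaus theorem, and this is a Frobenius complement. -/
theorem isFrobenius_of_fixedPointFree (h1 : fitting G ≠ ⊥) (h2 : fitting G ≠ ⊤)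
    (h : ∀ g ∉ fitting G, FixedPointFree (fitting G) g) : IsFrobenius G := by
  have hcop : (Nat.card (fitting G)).Coprime (fitting G).index := by
    refine Nat.coprime_of_dvd fun p hp hpF hpi => ?_
    have := Fact.mk hp
    obtain ⟨x, hx⟩ := exists_prime_orderOf_dvd_card' (G := G ⧸ fitting G) p hpi
    obtain ⟨g, rfl⟩ := QuotientGroup.mk_surjective x
    have hg : FixedPointFree (fitting G) g := h g fun hgF => by
      rw [(QuotientGroup.eq_one_iff g).2 hgF, orderOf_one] at hx
      exact hp.one_lt.ne hx
    exact hg.not_dvd_card (k := 1) hp (by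
      rw [pow_one]; exact hg.pow_eq_one (hx ▸ pow_orderOf_eq_one _)) hpF
  obtain ⟨H, hH⟩ := Subgroup.exists_right_complement'_of_coprime hcop
  refine ⟨H, ?_, ?_, fun g hg => ?_⟩
  · rintro rfl
    exact h2 (Subgroup.isComplement'_bot_right.1 hH)
  · rintro rfl
    exact h1 (Subgroup.isComplement'_top_right.1 hH)
  · rw [eq_bot_iff]
    rintro x ⟨hxH, k, hk, hkx⟩
    have hkx : g * k * g⁻¹ = x := hkx
    rw [Subgroup.mem_bot]
    by_contra hx1
    obtain ⟨⟨f, g'⟩, hfg⟩ := hH.2 g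
    have hfg : (f : G) * (g' : G) = g := hfg
    have hdisj : ∀ z ∈ fitting G, z ∈ H → z = 1 := fun z hz hz' =>
      Subgroup.disjoint_def.1 hH.disjoint hz hz'
    have hk' : (g' : G) * k * (g' : G)⁻¹ ∈ H := H.mul_mem (H.mul_mem g'.2 hk) (H.inv_mem g'.2)
    set k' := (g' : G) * k * (g' : G)⁻¹ with hk'def
    have hxk : x = f * k' * (f : G)⁻¹ := by
      rw [← hkx, ← hfg, hk'def]; group
    have h3 : x * k'⁻¹ = 1 := by
      refine hdisj _ ?_ (H.mul_mem hxH (H.inv_mem hk'))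
      have := (fitting G).mul_mem f.2 ((fitting_normal).conj_mem _ ((fitting G).inv_mem f.2) k')
      rw [hxk]
      simpa [mul_assoc] using this
    have h4 : x = k' := mul_inv_eq_one.1 h3
    have h5 : (f : G) = 1 := by
      refine h x (fun hxF => hx1 (hdisj x hxF hxH)) f f.2 ?_
      rw [← h4] at hxk
      exact (eq_mul_inv_iff_mul_eq.1 hxk).symm
    exact hg (by rw [← hfg, h5, one_mul]; exact g'.2)

/-- Every element has an Engel edge to every element of the Fitting subgroup. -/
theorem EngelRel.of_mem_fitting (x : G) {f : G} (hf : f ∈ fitting G) : EngelRel x f := by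
  obtain ⟨n, hn⟩ := (Subgroup.isNilpotent_iff_lowerCentralSeries (fitting G)).1 fitting_nilpotent
  have h1 : ∀ k, engelWord x f (k + 1) ∈ (fitting G).lowerCentralSeries k := by
    intro k
    induction k with
    | zero =>
      rw [Subgroup.lowerCentralSeries_zero]
      exact mul_mem ((fitting_normal).conj_mem' _ (inv_mem hf) x) hf
    | succ k ih =>
      rw [Subgroup.lowerCentralSeries_succ]
      have := Subgroup.commutator_mem_commutator (inv_mem ih) (inv_mem hf)
      rw [commutatorElement_def, inv_inv, inv_inv] at this
      exact this
  have h2 := h1 n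
  rw [hn, Subgroup.mem_bot] at h2
  exact ⟨n + 1, h2⟩

/-- The case of a trivial center, where the vertices are the non-trivial elements. The first vertex
`u` of the chain is taken in the Fitting subgroup. -/
theorem exists_engelRel_chain [Group.IsSolvable G] (hZ : Subgroup.center G = ⊥)
    (hG : ¬ IsFrobenius G) {x y : G} (hy : y ≠ 1) :
    ∃ u v w : G, u ≠ 1 ∧ v ≠ 1 ∧ w ≠ 1 ∧
      EngelRel x u ∧ EngelRel u v ∧ EngelRel v w ∧ EngelRel w y := by
  have hnt : Nontrivial G := ⟨y, 1, hy⟩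
  by_contra! hno
  refine hG (isFrobenius_of_fixedPointFree fitting_ne_bot (fun htop => ?_) fun g hg =>
    fixedPointFree_of_forall_engelRel hy (fun v w hv hw hvw hwy f hf hfv => ?_) hg)
  · have h1 : Group.IsNilpotent G := by
      rw [← Group.isNilpotent_top, ← htop]
      exact fitting_nilpotent
    exact Group.IsNilpotent.center_ne_bot G hZ
  · by_contra hf1
    exact hno f v w hf1 hv hw (EngelRel.of_mem_fitting x hf) (EngelRel.of_commute hfv) hvw hwy

end FittingAction

section Diameter

/-- The Engel graph of a finite soluble group `G` such that `G / Z_∞(G)` is not a Frobenius group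
is strongly connected, of diameter at most four. -/
theorem engelGraph_hasWalk_four {G : Type*} [Group G] [Finite G] [Group.IsSolvable G]
    (hG : ¬ IsFrobenius (G ⧸ hypercenter G)) (x y : {g : G // g ∉ hypercenter G}) :
    HasWalk (engelGraph G) 4 x y := by
  have hne : ∀ g : G, (g : G ⧸ hypercenter G) ≠ 1 ↔ g ∉ hypercenter G := fun g => by
    rw [Ne, QuotientGroup.eq_one_iff]
  obtain ⟨u, v, w, hu, hv, hw, h1, h2, h3, h4⟩ := exists_engelRel_chain center_quotient_hypercenter
    hG (x := (x : G)) ((hne y).2 y.2)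
  obtain ⟨u, rfl⟩ := QuotientGroup.mk_surjective u
  obtain ⟨v, rfl⟩ := QuotientGroup.mk_surjective v
  obtain ⟨w, rfl⟩ := QuotientGroup.mk_surjective w
  have key : ∀ a b : {g : G // g ∉ hypercenter G},
      EngelRel ((a : G) : G ⧸ hypercenter G) ((b : G) : G ⧸ hypercenter G) →
        (engelGraph G).Adj a b := fun a b h =>
    (engelRel_iff_pos _ _).1 h.of_quotient_hypercenter
  exact ⟨⟨u, (hne u).1 hu⟩, key _ _ h1, ⟨v, (hne v).1 hv⟩, key _ _ h2, ⟨w, (hne w).1 hw⟩,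
    key _ _ h3, y, key _ _ h4, rfl⟩

theorem diam_le_of_hasWalk {V : Type*} {Γ : Digraph V} {n : ℕ} (h : ∀ x y, HasWalk Γ n x y) :
    diam Γ ≤ n :=
  iSup₂_le fun x y => iInf₂_le n (h x y)

end Diameter

/-! ### Semidirect products with Engel graph of large diameter -/

section SemidirectProduct

open SemidirectProduct

variable {P D : Type*} [CommGroup P] [Group D] {φ : D →* MulAut P}

/-- If `d` has no fixed points modulo the invariant subgroup `Q` of `P`, then only elements with
`P`-component in `Q` have an Engel edge to `d`. -/
theorem left_mem_of_engelRel_inr {Q : Subgroup P} (hQ : ∀ (h : D), ∀ v ∈ Q, φ h v ∈ Q) {d : D}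
    (hd : ∀ v, φ d v * v⁻¹ ∈ Q → v ∈ Q) {x : P ⋊[φ] D} (hx : EngelRel x (inr d)) : x.left ∈ Q := by
  have key : ∀ e : P ⋊[φ] D, (e⁻¹ * (inr d)⁻¹ * e * inr d).left ∈ Q → e.left ∈ Q := by
    intro e he
    have h1 : (e⁻¹ * (inr d)⁻¹ * e * inr d).left =
        φ e.right⁻¹ (e.left⁻¹ * φ d⁻¹ e.left) := by
      simp [mul_left, inv_left, inv_right, map_mul, mul_assoc]
    rw [h1] at he
    have h2 := hQ d _ (hQ e.right _ he)
    simp only [map_inv, MulAut.apply_inv_self, map_mul] at h2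
    refine hd _ ?_
    have h3 := Q.inv_mem h2
    rwa [mul_inv, inv_inv] at h3
  obtain ⟨n, hn⟩ := hx
  have h1 : ∀ k, k ≤ n → (engelWord x (inr d) (n - k)).left ∈ Q := by
    intro k
    induction k with
    | zero =>
      intro _
      rw [Nat.sub_zero, hn]
      exact Q.one_mem
    | succ k ih =>
      intro hk
      apply key
      have h2 : n - k = n - (k + 1) + 1 := by omega
      have h3 := ih (by omega)
      rw [h2] at h3
      exact h3
  have h2 := h1 n le_rfl
  rw [Nat.sub_self] at h2
  exact h2

/-- The case `Q = 1` of `left_mem_of_engelRel_inr`. -/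
theorem left_eq_one_of_engelRel_inr {d : D} (hd : ∀ v, φ d v = v → v = 1) {x : P ⋊[φ] D}
    (hx : EngelRel x (inr d)) : x.left = 1 :=
  Subgroup.mem_bot.1 (left_mem_of_engelRel_inr (Q := ⊥) (fun h v hv => by
    rw [Subgroup.mem_bot] at hv ⊢; rw [hv, map_one]) (fun v hv => by
    rw [Subgroup.mem_bot] at hv ⊢; exact hd v (mul_inv_eq_one.1 hv)) hx)

theorem center_semidirectProduct_eq_bot (hφ : Function.Injective φ) {s : D}
    (hs : ∀ v, φ s v = v → v = 1) : Subgroup.center (P ⋊[φ] D) = ⊥ := by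
  rw [eq_bot_iff]
  intro x hx
  have h1 := Subgroup.mem_center_iff.1 hx
  have h2 : x.left = 1 := by
    have := congrArg SemidirectProduct.left (h1 (inr s))
    exact hs _ (by simpa using this)
  have h3 : x.right = 1 := by
    refine hφ (MulEquiv.ext fun v => ?_)
    have := congrArg SemidirectProduct.left (h1 (inl v))
    rw [map_one, MulAut.one_apply]
    simpa [h2] using this.symm
  exact Subgroup.mem_bot.2 (SemidirectProduct.ext h2 h3)

/-- In `P ⋊ D` any two non-trivial elements are linked by a chain of non-trivial elements in which
neighbours commute, so `P ⋊ D` is not a Frobenius group. Here `s` is central in `D` and acts on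
`P` without fixed points, while `c` has a fixed point. -/
theorem not_isFrobenius_semidirectProduct [Finite P] {s c : D} (hs : ∀ v, φ s v = v → v = 1)
    (hsD : ∀ d, Commute s d) (hc : c ≠ 1) {v₀ : P} (hv₀ : v₀ ≠ 1) (hcv₀ : φ c v₀ = v₀) :
    ¬ IsFrobenius (P ⋊[φ] D) := by
  rintro ⟨H, hH1, hHtop, hmal⟩
  have hconj : ∀ {g h : P ⋊[φ] D}, h ∈ H → h ≠ 1 → g⁻¹ * h * g ∈ H → g ∈ H := by
    intro g h hh hh1 hgh
    by_contra hg
    have h1 : h ∈ H ⊓ H.map (MulAut.conj g).toMonoidHom :=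
      ⟨hh, g⁻¹ * h * g, hgh, by simp [mul_assoc]⟩
    rw [hmal g hg] at h1
    exact hh1 h1
  have hcomm : ∀ {g h : P ⋊[φ] D}, h ∈ H → h ≠ 1 → Commute g h → g ∈ H := by
    intro g h hh hh1 hgh
    refine hconj hh hh1 ?_
    rwa [mul_assoc, ← hgh.eq, inv_mul_cancel_left]
  have hinl : ∀ u v : P, Commute (inl u : P ⋊[φ] D) (inl v) := fun u v => by
    change inl u * inl v = inl v * inl u
    rw [← map_mul, mul_comm, map_mul]
  have hinl1 : ∀ v : P, v ≠ 1 → (inl v : P ⋊[φ] D) ≠ 1 := fun v hv h =>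
    hv (inl_injective (h.trans (map_one inl).symm))
  have hinr1 : ∀ d : D, d ≠ 1 → (inr d : P ⋊[φ] D) ≠ 1 := fun v hv h =>
    hv (inr_injective (h.trans (map_one inr).symm))
  -- `H` does not meet `P`, as otherwise it would contain the normal subgroup `P`
  have hA : ∀ v : P, v ≠ 1 → (inl v : P ⋊[φ] D) ∉ H := by
    intro v hv hvH
    refine hHtop ((Subgroup.eq_top_iff' H).2 fun g => ?_)
    refine hconj hvH (hinl1 v hv) (hcomm hvH (hinl1 v hv) ?_)
    have : g⁻¹ * inl v * g = inl (g⁻¹ * inl v * g).left :=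
      SemidirectProduct.ext (by simp) (by simp)
    rw [this]
    exact hinl _ _
  have hs1 : s ≠ 1 := by
    rintro rfl
    exact hv₀ (hs v₀ (by simp))
  obtain ⟨⟨h, hh⟩, hh1⟩ := Subgroup.ne_bot_iff_exists_ne_one.1 hH1
  have hh1 : h ≠ 1 := fun h0 => hh1 (Subtype.ext h0)
  by_cases hfix : ∃ v, φ h.right v = v ∧ v ≠ 1
  · obtain ⟨v, hv, hv1⟩ := hfix
    refine hA v hv1 (hcomm hh hh1 ?_)
    refine SemidirectProduct.ext ?_ (by simp)
    simp [hv, mul_comm]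
  · push Not at hfix
    -- `h` is conjugate to an element of `D`
    let ψ : P →* P := ⟨⟨fun u => u * φ h.right u⁻¹, by simp⟩, fun u v => by
      simp only [mul_inv, map_mul, mul_mul_mul_comm]⟩
    have hψ : Function.Injective ψ := by
      rw [injective_iff_map_eq_one]
      intro u hu
      refine hfix u ?_
      have : u * φ h.right u⁻¹ = 1 := hu
      rw [map_inv, mul_inv_eq_one] at this
      exact this.symm
    obtain ⟨u, hu⟩ := Finite.surjective_of_injective hψ h.left
    have hu : u * φ h.right u⁻¹ = h.left := hu
    have hconjh : h = inl u * inr h.right * (inl u)⁻¹ := by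
      refine SemidirectProduct.ext ?_ (by simp)
      rw [← hu]
      simp [← map_inv]
    have hcj : ∀ d d' : D, Commute d d' →
        Commute ((inl u : P ⋊[φ] D) * inr d * (inl u)⁻¹) (inl u * inr d' * (inl u)⁻¹) := by
      intro d d' hdd
      have : Commute (inr d : P ⋊[φ] D) (inr d') := by
        change inr d * inr d' = inr d' * inr d
        rw [← map_mul, hdd.eq, map_mul]
      change inl u * inr d * (inl u)⁻¹ * (inl u * inr d' * (inl u)⁻¹) =
        inl u * inr d' * (inl u)⁻¹ * (inl u * inr d * (inl u)⁻¹)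
      calc _ = inl u * (inr d * inr d') * (inl u)⁻¹ := by group
        _ = _ := by rw [this.eq]; group
    have hne : ∀ d : D, d ≠ 1 → (inl u : P ⋊[φ] D) * inr d * (inl u)⁻¹ ≠ 1 := by
      intro d hd h0
      refine hinr1 d hd ?_
      rwa [mul_inv_eq_one, mul_eq_left] at h0
    have hS : inl u * inr s * (inl u)⁻¹ ∈ H := by
      refine hcomm hh hh1 ?_
      rw [hconjh]
      exact hcj _ _ (hsD _)
    have hC : inl u * inr c * (inl u)⁻¹ ∈ H := hcomm hS (hne s hs1) (hcj _ _ (hsD c).symm)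
    refine hA v₀ hv₀ (hcomm hC (hne c hc) ?_)
    refine SemidirectProduct.ext ?_ (by simp)
    simp only [mul_left, left_inl, left_inr, mul_right, right_inl, right_inr, map_one, one_mul,
      mul_one, MulAut.one_apply, ← map_inv, hcv₀]
    simp [mul_comm]

/-- A lower bound for the diameter of the Engel graph of `P ⋊ D`. Walking backwards from `w`, one
meets only elements of `D` in two steps, as `w` and all its predecessors in `D` act on `P` without
fixed points. In the third step one stays within `Q D`, where `Q` is a proper subgroup of `P` such
that the elements of `D` with fixed points on `P` have none on `P / Q`. -/
theorem not_hasWalk_three_semidirectProduct {Q : Subgroup P}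
    (hQ : ∀ (h : D), ∀ v ∈ Q, φ h v ∈ Q) {w : D} (hw : ∀ v, φ w v = v → v = 1)
    (hpred : ∀ d : D, d ≠ 1 → EngelRel d w → ∀ v, φ d v = v → v = 1)
    (hfix : ∀ d : D, d ≠ 1 → (∀ v, φ d v = v → v = 1) ∨ (∀ v, φ d v * v⁻¹ ∈ Q → v ∈ Q))
    {x y : {g : P ⋊[φ] D // g ∉ hypercenter (P ⋊[φ] D)}} (hx : (x : P ⋊[φ] D).left ∉ Q)
    (hy : (y : P ⋊[φ] D) = inr w) : ¬ HasWalk (engelGraph (P ⋊[φ] D)) 3 x y := by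
  rintro ⟨u, hxu, v, huv, y', hvy, rfl⟩
  have hadj : ∀ {a b : {g : P ⋊[φ] D // g ∉ hypercenter (P ⋊[φ] D)}},
      (engelGraph (P ⋊[φ] D)).Adj a b → EngelRel (a : P ⋊[φ] D) b :=
    fun h => (engelRel_iff_pos _ _).2 h
  have hne : ∀ a : {g : P ⋊[φ] D // g ∉ hypercenter (P ⋊[φ] D)},
      (a : P ⋊[φ] D).left = 1 →
        (a : P ⋊[φ] D).right ≠ 1 ∧ (a : P ⋊[φ] D) = inr (a : P ⋊[φ] D).right :=
    fun a ha => ⟨fun h => a.2 ((SemidirectProduct.ext ha h : (a : P ⋊[φ] D) = 1) ▸ one_mem _),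
      SemidirectProduct.ext (by simpa using ha) (by simp)⟩
  have h1 := hadj hvy
  rw [hy] at h1
  obtain ⟨hv1, hv⟩ := hne v (left_eq_one_of_engelRel_inr hw h1)
  have h2 : EngelRel (v : P ⋊[φ] D).right w := by
    obtain ⟨n, hn⟩ := h1
    exact ⟨n, by simpa [map_engelWord] using congrArg rightHom hn⟩
  have h3 := hadj huv
  rw [hv] at h3
  obtain ⟨hu1, hu⟩ := hne u (left_eq_one_of_engelRel_inr (hpred _ hv1 h2) h3)
  have h4 := hadj hxu
  rw [hu] at h4
  rcases hfix _ hu1 with h5 | h5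
  · exact hx (left_eq_one_of_engelRel_inr h5 h4 ▸ Q.one_mem)
  · exact hx (left_mem_of_engelRel_inr hQ h5 h4)

theorem le_diam_of_not_hasWalk {V : Type*} {Γ : Digraph V} {n : ℕ} {x y : V}
    (hloop : ∀ x, Γ.Adj x x) (h : ¬ HasWalk Γ n x y) : ((n + 1 : ℕ) : ℕ∞) ≤ diam Γ := by
  have hmono : ∀ m k : ℕ, HasWalk Γ m x y → HasWalk Γ (m + k) x y := by
    intro m k hm
    induction k with
    | zero => exact hm
    | succ k ih => exact ⟨x, hloop x, ih⟩
  refine le_trans ?_ (le_iSup₂ (f := fun x y => dist Γ x y) x y)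
  refine le_iInf₂ fun m hm => ?_
  by_contra hlt
  rw [not_le, Nat.cast_lt] at hlt
  exact h (by simpa [Nat.add_sub_of_le (Nat.lt_succ_iff.1 hlt)] using hmono m (n - m) hm)

end SemidirectProduct

/-! ### Semilinear maps of the plane -/

section Semilinear

theorem plane_ext {L : Type*} {v w : Plane L} (h0 : v.toAdd 0 = w.toAdd 0)
    (h1 : v.toAdd 1 = w.toAdd 1) : v = w :=
  Multiplicative.toAdd.injective (funext fun i => by fin_cases i; exacts [h0, h1])

variable {K L : Type*} [Field L]

/-- The action of the diagonal matrices on the plane, as a homomorphism. -/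
noncomputable def diagAut : Lˣ × Lˣ →* MulAut (Plane L) where
  toFun p := glAut (diagGL p.1 p.2)
  map_one' := by
    refine MulEquiv.ext fun v => funext fun i => ?_
    change (!![((1 : Lˣ) : L), 0; 0, ((1 : Lˣ) : L)] *ᵥ v.toAdd) i = v.toAdd i
    fin_cases i <;> simp [Matrix.mulVec, dotProduct]
  map_mul' p p' := by
    refine MulEquiv.ext fun v => funext fun i => ?_
    change (!![((p.1 * p'.1 : Lˣ) : L), 0; 0, ((p.2 * p'.2 : Lˣ) : L)] *ᵥ v.toAdd) i =
      (!![(p.1 : L), 0; 0, (p.2 : L)] *ᵥ (!![(p'.1 : L), 0; 0, (p'.2 : L)] *ᵥ v.toAdd)) i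
    fin_cases i <;> simp [Matrix.mulVec, dotProduct, mul_assoc]

theorem diagAut_apply_zero (p : Lˣ × Lˣ) (v : Plane L) :
    (diagAut p v).toAdd 0 = p.1 * v.toAdd 0 := by
  change (!![(p.1 : L), 0; 0, (p.2 : L)] *ᵥ v.toAdd) 0 = _
  simp [Matrix.mulVec, dotProduct]

theorem diagAut_apply_one (p : Lˣ × Lˣ) (v : Plane L) :
    (diagAut p v).toAdd 1 = p.2 * v.toAdd 1 := by
  change (!![(p.1 : L), 0; 0, (p.2 : L)] *ᵥ v.toAdd) 1 = _
  simp [Matrix.mulVec, dotProduct]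

theorem diagAut_injective : Function.Injective (diagAut (L := L)) := by
  intro p p' h
  have h1 := congrArg (fun A : MulAut (Plane L) =>
    (A (Multiplicative.ofAdd fun _ => 1)).toAdd) h
  have h2 := congrFun h1 0
  have h3 := congrFun h1 1
  simp only [diagAut_apply_zero, diagAut_apply_one, toAdd_ofAdd, mul_one] at h2 h3
  exact Prod.ext (Units.ext h2) (Units.ext h3)

/-- A diagonal automorphism without eigenvalue `1` has no fixed points. -/
theorem eq_one_of_diagAut_apply_eq {p : Lˣ × Lˣ} (h1 : p.1 ≠ 1) (h2 : p.2 ≠ 1) {v : Plane L}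
    (hv : diagAut p v = v) : v = 1 := by
  have key : ∀ {a : Lˣ} {x : L}, a ≠ 1 → a * x = x → x = 0 := fun ha hx => by
    by_contra h0
    exact ha (Units.ext (mul_right_cancel₀ h0 (hx.trans (one_mul _).symm)))
  refine plane_ext (key h1 ?_) (key h2 ?_)
  · rw [← diagAut_apply_zero, hv]
  · rw [← diagAut_apply_one, hv]

variable [Field K] [Fintype K] [Algebra K L] [FiniteDimensional K L]

theorem fieldAut_frobAut_apply (v : Plane L) (i : Fin 2) :
    (fieldAut (frobAut K L) v).toAdd i = v.toAdd i ^ Fintype.card K := rfl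

theorem fieldAut_frobAut_pow_apply (j : ℕ) (v : Plane L) (i : Fin 2) :
    ((fieldAut (frobAut K L) ^ j) v).toAdd i = v.toAdd i ^ Fintype.card K ^ j := by
  induction j with
  | zero => simp
  | succ j ih => rw [pow_succ', MulAut.mul_apply, fieldAut_frobAut_apply, ih, ← pow_mul, pow_succ]

theorem fieldAut_frobAut_mul_diagAut (p : Lˣ × Lˣ) :
    fieldAut (frobAut K L) * diagAut p = diagAut (p ^ Fintype.card K) * fieldAut (frobAut K L) := by
  refine MulEquiv.ext fun v => plane_ext ?_ ?_
  · simp only [MulAut.mul_apply, diagAut_apply_zero, fieldAut_frobAut_apply, mul_pow, Prod.pow_fst,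
      Units.val_pow_eq_pow_val]
  · simp only [MulAut.mul_apply, diagAut_apply_one, fieldAut_frobAut_apply, mul_pow, Prod.pow_snd,
      Units.val_pow_eq_pow_val]

theorem pow_card_pow_finrank (x : L) : x ^ Fintype.card K ^ Module.finrank K L = x := by
  have := Module.finite_of_finite K (M := L)
  have := Fintype.ofFinite L
  rw [← Module.card_eq_pow_finrank (K := K) (V := L), FiniteField.pow_card]

variable (K) in
/-- The semilinear map `zβ`, where `z = diag(e, e)`. -/
noncomputable def scalarFrob (e : Lˣ) : MulAut (Plane L) :=
  glAut (diagGL e e) * fieldAut (frobAut K L)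

theorem scalarFrob_mul_diagAut (e : Lˣ) (p : Lˣ × Lˣ) :
    scalarFrob K e * diagAut p = diagAut (p ^ Fintype.card K) * scalarFrob K e := by
  change diagAut (e, e) * fieldAut (frobAut K L) * diagAut p =
    diagAut (p ^ Fintype.card K) * (diagAut (e, e) * fieldAut (frobAut K L))
  rw [mul_assoc, fieldAut_frobAut_mul_diagAut, ← mul_assoc, ← mul_assoc, ← map_mul, ← map_mul,
    mul_comm]

theorem scalarFrob_pow_mul_diagAut (e : Lˣ) (p : Lˣ × Lˣ) (j : ℕ) :
    scalarFrob K e ^ j * diagAut p = diagAut (p ^ Fintype.card K ^ j) * scalarFrob K e ^ j := by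
  induction j with
  | zero => simp
  | succ j ih =>
    rw [pow_succ', mul_assoc, ih, ← mul_assoc, scalarFrob_mul_diagAut, mul_assoc, ← pow_mul,
      pow_succ (Fintype.card K)]

theorem scalarFrob_pow (e : Lˣ) (j : ℕ) :
    scalarFrob K e ^ j =
      diagAut (e ^ ∑ i ∈ Finset.range j, Fintype.card K ^ i,
        e ^ ∑ i ∈ Finset.range j, Fintype.card K ^ i) * fieldAut (frobAut K L) ^ j := by
  induction j with
  | zero => simp [← Prod.one_eq_mk]
  | succ j ih =>
    rw [pow_succ', ih, ← mul_assoc, scalarFrob_mul_diagAut]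
    change _ * (diagAut (e, e) * _) * _ = _
    rw [← mul_assoc, ← map_mul, mul_assoc, ← pow_succ', geom_sum_succ]
    congr 2
    ext <;> simp [← pow_mul, pow_succ, mul_comm]

theorem scalarFrob_pow_finrank (e : Lˣ) :
    scalarFrob K e ^ Module.finrank K L =
      diagAut (e ^ ∑ i ∈ Finset.range (Module.finrank K L), Fintype.card K ^ i,
        e ^ ∑ i ∈ Finset.range (Module.finrank K L), Fintype.card K ^ i) := by
  rw [scalarFrob_pow]
  convert mul_one _
  refine MulEquiv.ext fun v => plane_ext ?_ ?_ <;>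
  · rw [fieldAut_frobAut_pow_apply, pow_card_pow_finrank, MulAut.one_apply]

theorem units_pow_card_pow_finrank (u : Lˣ) :
    u ^ Fintype.card K ^ Module.finrank K L = u :=
  Units.ext (by rw [Units.val_pow_eq_pow_val, pow_card_pow_finrank])

/-- Each element of `⟨zβ, c⟩` has the form `cⁱ(zβ)ʲ`. -/
theorem exists_eq_of_mem_exampleD {e f : Lˣ} {d : MulAut (Plane L)} (hd : d ∈ exampleD K L e f) :
    ∃ i j : ℕ, d = diagAut (1, f ^ i) * scalarFrob K e ^ j := by
  have := Module.finite_of_finite K (M := L)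
  have : Finite (MulAut (Plane L)) :=
    Finite.of_injective (fun A : MulAut (Plane L) => (A : Plane L → Plane L)) DFunLike.coe_injective
  have hmul : ∀ a b : MulAut (Plane L),
      (∃ i j : ℕ, a = diagAut (1, f ^ i) * scalarFrob K e ^ j) →
      (∃ i j : ℕ, b = diagAut (1, f ^ i) * scalarFrob K e ^ j) →
      ∃ i j : ℕ, a * b = diagAut (1, f ^ i) * scalarFrob K e ^ j := by
    rintro _ _ ⟨i, j, rfl⟩ ⟨i', j', rfl⟩
    refine ⟨i + i' * Fintype.card K ^ j, j + j', ?_⟩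
    rw [mul_assoc, ← mul_assoc (scalarFrob K e ^ j), scalarFrob_pow_mul_diagAut, mul_assoc,
      ← mul_assoc, ← map_mul, ← pow_add]
    simp [pow_add, pow_mul]
  have hone : ∃ i j : ℕ, (1 : MulAut (Plane L)) = diagAut (1, f ^ i) * scalarFrob K e ^ j :=
    ⟨0, 0, by simp [← Prod.one_eq_mk]⟩
  induction hd using Subgroup.closure_induction with
  | mem x hx =>
    rcases hx with rfl | rfl
    · exact ⟨0, 1, by simp [← Prod.one_eq_mk, scalarFrob]⟩
    · exact ⟨1, 0, by simp; rfl⟩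
  | one => exact hone
  | mul a b _ _ ha hb => exact hmul a b ha hb
  | inv a _ ha =>
    have h1 : a⁻¹ = a ^ (orderOf a - 1) := by
      rw [inv_eq_iff_mul_eq_one, mul_pow_sub_one (orderOf_pos a).ne', pow_orderOf_eq_one]
    rw [h1]
    induction orderOf a - 1 with
    | zero => rw [pow_zero]; exact hone
    | succ n ih => rw [pow_succ]; exact hmul _ _ ih ha

end Semilinear

/-! ### The group generated by a semilinear and a diagonal map -/

theorem IsFrobenius.of_mulEquiv {G H : Type*} [Group G] [Group H] (e : G ≃* H)
    (h : IsFrobenius G) : IsFrobenius H := by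
  obtain ⟨M, h1, h2, h3⟩ := h
  refine ⟨M.map e.toMonoidHom, ?_, ?_, ?_⟩
  · rwa [Ne, Subgroup.map_eq_bot_iff_of_injective _ e.injective]
  · intro h
    refine h2 ((Subgroup.eq_top_iff' M).2 fun g => ?_)
    obtain ⟨m, hm, hmg⟩ : e g ∈ M.map e.toMonoidHom := h ▸ Subgroup.mem_top _
    exact e.injective hmg ▸ hm
  · intro g hg
    rw [eq_bot_iff]
    rintro _ ⟨⟨m, hm, rfl⟩, ⟨_, ⟨k, hk, rfl⟩, hmk⟩⟩
    have h4 : e.symm g ∉ M := fun h => hg ⟨_, h, e.apply_symm_apply g⟩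
    have h5 : m ∈ M ⊓ M.map (MulAut.conj (e.symm g)).toMonoidHom := by
      refine ⟨hm, k, hk, e.injective ?_⟩
      have h6 : g * e k * g⁻¹ = e m := hmk
      simpa using h6
    rw [h3 _ h4, Subgroup.mem_bot] at h5
    rw [h5, map_one]
    exact one_mem _

section ExampleGroup

variable {K L : Type*} [Field K] [Fintype K] [Field L] [Algebra K L] [FiniteDimensional K L]
  {e f : Lˣ}

theorem isSolvable_exampleD : Group.IsSolvable (exampleD K L e f) := by
  let A := (diagAut (L := L)).range.subgroupOf (exampleD K L e f)
  have hA : Group.IsSolvable A := Group.isSolvable_of_comm fun a b => by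
    obtain ⟨a, p, hp⟩ := a
    obtain ⟨b, p', hp'⟩ := b
    refine Subtype.ext (Subtype.ext ?_)
    change (exampleD K L e f).subtype a * (exampleD K L e f).subtype b =
      (exampleD K L e f).subtype b * (exampleD K L e f).subtype a
    rw [← hp, ← hp', ← map_mul, mul_comm, map_mul]
  have hAn : A.Normal := by
    refine ⟨?_⟩
    rintro ⟨_, _⟩ ⟨p, rfl⟩ ⟨g, hg⟩
    obtain ⟨i, j, rfl⟩ := exists_eq_of_mem_exampleD hg
    refine ⟨p ^ Fintype.card K ^ j, ?_⟩
    change _ = diagAut (1, f ^ i) * scalarFrob K e ^ j * diagAut p *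
      (diagAut (1, f ^ i) * scalarFrob K e ^ j)⁻¹
    rw [eq_mul_inv_iff_mul_eq, mul_assoc _ _ (diagAut p), scalarFrob_pow_mul_diagAut, ← mul_assoc,
      ← mul_assoc, ← map_mul, ← map_mul, mul_comm]
  have hw : scalarFrob K e ∈ exampleD K L e f := Subgroup.subset_closure (Or.inl rfl)
  have hQ : Group.IsSolvable (exampleD K L e f ⧸ A) := by
    have key : ∀ a : exampleD K L e f ⧸ A, ∃ j : ℕ,
        a = (QuotientGroup.mk' A ⟨scalarFrob K e, hw⟩) ^ j := by
      intro a
      induction a using QuotientGroup.induction_on with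
      | H a =>
        obtain ⟨a, ha⟩ := a
        obtain ⟨i, j, rfl⟩ := exists_eq_of_mem_exampleD ha
        refine ⟨j, ?_⟩
        rw [← map_pow]
        change QuotientGroup.mk' A _ = _
        rw [← mul_inv_eq_one, ← map_inv, ← map_mul, ← MonoidHom.mem_ker, QuotientGroup.ker_mk']
        exact ⟨(1, f ^ i), by simp⟩
    refine Group.isSolvable_of_comm fun a b => ?_
    obtain ⟨i, rfl⟩ := key a
    obtain ⟨j, rfl⟩ := key b
    exact (Commute.refl _).pow_pow i j
  exact Group.isSolvable_of_ker_le_range A.subtype (QuotientGroup.mk' A) (by simp)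

theorem finite_exampleGroup : Finite (ExampleGroup K L e f) := by
  have := Module.finite_of_finite K (M := L)
  have : Finite (MulAut (Plane L)) :=
    Finite.of_injective (fun A : MulAut (Plane L) => (A : Plane L → Plane L)) DFunLike.coe_injective
  exact Finite.of_equiv _ SemidirectProduct.equivProd.symm

theorem isSolvable_exampleGroup : Group.IsSolvable (ExampleGroup K L e f) := by
  have := isSolvable_exampleD (K := K) (e := e) (f := f)
  exact Group.isSolvable_of_ker_le_range SemidirectProduct.inl SemidirectProduct.rightHom
    SemidirectProduct.range_inl_eq_ker_rightHom.ge

variable {r t : ℕ}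

/-- The elements `diag(ε, εu)` with `ε ≠ 1` of order prime to that of `u` have no fixed points. -/
theorem eq_one_of_diagAut_mul_apply_eq {ε u : Lˣ} (hr : r.Prime) (ht : t.Prime) (hrt : r ≠ t)
    (hε : ε ^ r = 1) (hε1 : ε ≠ 1) (hu : u ^ t = 1) {v : Plane L}
    (hv : diagAut (ε, ε * u) v = v) : v = 1 := by
  refine eq_one_of_diagAut_apply_eq hε1 (fun h => hε1 ?_) hv
  have h1 : ε ^ t = 1 := by
    rw [← mul_one (ε ^ t), ← hu, ← mul_pow, show ε * u = 1 from h, one_pow, hu]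
  exact orderOf_eq_one_iff.1 (Nat.eq_one_of_dvd_coprimes ((Nat.coprime_primes hr ht).2 hrt)
    (orderOf_dvd_of_pow_eq_one hε) (orderOf_dvd_of_pow_eq_one h1))

/-- The elements of `⟨zβ, c⟩` that have a non-trivial fixed point are powers of `c`. Here `(zβ)ʳ` is
the scalar `ε = e ^ N` of order `r`, where `N = 1 + q + ⋯ + q ^ (r - 1)`. If `r ∤ j`, then the `r`-th
power of `cⁱ(zβ)ʲ` is `diag(εʲ, εʲu)` for some `u ∈ ⟨f⟩`, and this has no fixed points. -/
theorem fixedPoints_of_mem_exampleD (hr : (Module.finrank K L).Prime) (ht : t.Prime)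
    (hrt : Module.finrank K L ≠ t)
    (hε : orderOf (e ^ ∑ i ∈ Finset.range (Module.finrank K L), Fintype.card K ^ i) =
      Module.finrank K L) (hf : f ^ t = 1)
    {d : MulAut (Plane L)} (hd : d ∈ exampleD K L e f) :
    (∀ v, d v = v → v = 1) ∨ ∃ i : ℕ, d = diagAut (1, f ^ i) := by
  set r := Module.finrank K L with hrdef
  set ε := e ^ ∑ i ∈ Finset.range r, Fintype.card K ^ i with hεdef
  have hfpow : ∀ i : ℕ, (f ^ i) ^ t = 1 := fun i => by
    rw [← pow_mul, mul_comm, pow_mul, hf, one_pow]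
  have hεpow : ∀ i : ℕ, (ε ^ i) ^ r = 1 := fun i => by
    rw [← pow_mul, mul_comm, pow_mul, ← hε, pow_orderOf_eq_one, one_pow]
  have hε1 : ∀ i : ℕ, ¬ r ∣ i → ε ^ i ≠ 1 := fun i hi h =>
    hi (hε ▸ orderOf_dvd_of_pow_eq_one h)
  have hwr : ∀ m : ℕ, scalarFrob K e ^ (r * m) = diagAut (ε ^ m, ε ^ m) := fun m => by
    rw [pow_mul, hrdef, scalarFrob_pow_finrank, ← map_pow, Prod.pow_mk]
  obtain ⟨i, j, rfl⟩ := exists_eq_of_mem_exampleD hd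
  have hpow : ∀ m : ℕ, ∃ k : ℕ, (diagAut (1, f ^ i) * scalarFrob K e ^ j) ^ m =
      diagAut (1, f ^ k) * scalarFrob K e ^ (j * m) := by
    intro m
    induction m with
    | zero => exact ⟨0, by simp [← Prod.one_eq_mk]⟩
    | succ m ih =>
      obtain ⟨k, hk⟩ := ih
      refine ⟨k + i * Fintype.card K ^ (j * m), ?_⟩
      rw [pow_succ, hk, mul_assoc, ← mul_assoc (scalarFrob K e ^ (j * m)),
        scalarFrob_pow_mul_diagAut, mul_assoc, ← mul_assoc, ← map_mul, ← pow_add]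
      simp [pow_add, pow_mul, mul_add]
  by_cases hj : r ∣ j
  · obtain ⟨m, rfl⟩ := hj
    rw [hwr, ← map_mul, Prod.mk_mul_mk, one_mul, mul_comm]
    by_cases hm : r ∣ m
    · obtain ⟨l, rfl⟩ := hm
      exact Or.inr ⟨i, by rw [pow_mul, ← hε, pow_orderOf_eq_one, one_pow, one_mul]⟩
    · exact Or.inl fun v => eq_one_of_diagAut_mul_apply_eq hr ht hrt (hεpow m) (hε1 m hm) (hfpow i)
  · refine Or.inl fun v hv => ?_
    obtain ⟨k, hk⟩ := hpow r
    have h1 : ∀ m : ℕ, ((diagAut (1, f ^ i) * scalarFrob K e ^ j) ^ m) v = v := by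
      intro m
      induction m with
      | zero => rfl
      | succ m ih => rw [pow_succ, MulAut.mul_apply, hv, ih]
    have h2 := h1 r
    rw [hk, mul_comm j, hwr, ← map_mul, Prod.mk_mul_mk, one_mul, mul_comm] at h2
    exact eq_one_of_diagAut_mul_apply_eq hr ht hrt (hεpow j) (hε1 j hj) (hfpow k) h2

/-- `zβ` acts on `⟨c⟩` without fixed points, so no non-trivial element of `⟨c⟩` has an Engel edge
to `zβ`. -/
theorem eq_one_of_engelRel_scalarFrob (ht : t.Prime) (htq : ¬ t ∣ Fintype.card K - 1) {u : Lˣ}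
    (hu : u ^ t = 1) (h : EngelRel (diagAut (1, u)) (scalarFrob K e)) : u = 1 := by
  obtain ⟨n, hn⟩ := h
  induction n generalizing u with
  | zero => exact congrArg Prod.snd (diagAut_injective (hn.trans (map_one diagAut).symm))
  | succ n ih =>
    set q := Fintype.card K with hq
    have hrpos : 0 < Module.finrank K L := Module.finrank_pos
    have hinv : (u ^ q ^ (Module.finrank K L - 1)) ^ q = u := by
      rw [← pow_mul, ← pow_succ, Nat.sub_add_cancel hrpos, hq, units_pow_card_pow_finrank]
    have h1 : (diagAut (1, u))⁻¹ * (scalarFrob K e)⁻¹ * diagAut (1, u) * scalarFrob K e =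
        diagAut (1, u⁻¹ * u ^ q ^ (Module.finrank K L - 1)) := by
      have h2 : (scalarFrob K e)⁻¹ * diagAut (1, u) * scalarFrob K e =
          diagAut (1, u ^ q ^ (Module.finrank K L - 1)) := by
        rw [mul_assoc, inv_mul_eq_iff_eq_mul, scalarFrob_mul_diagAut, Prod.pow_mk, hinv, one_pow]
      rw [mul_assoc, mul_assoc, ← mul_assoc (scalarFrob K e)⁻¹, h2, ← map_inv, ← map_mul,
        Prod.inv_mk, Prod.mk_mul_mk, inv_one, one_mul]
    rw [engelWord_succ', h1] at hn
    have h2 := ih (by rw [mul_pow, inv_pow, hu, inv_one, one_mul, ← pow_mul, mul_comm, pow_mul, hu,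
      one_pow]) hn
    rw [inv_mul_eq_one] at h2
    rw [← h2] at hinv
    have h3 : u ^ (q - 1) = 1 := by
      have h4 : u ^ (q - 1) * u = 1 * u := by
        rw [← pow_succ, Nat.sub_add_cancel Fintype.card_pos, hinv, one_mul]
      exact mul_right_cancel h4
    exact orderOf_eq_one_iff.1 (Nat.eq_one_of_dvd_coprimes
      ((Nat.Prime.coprime_iff_not_dvd ht).2 htq) (orderOf_dvd_of_pow_eq_one hu)
      (orderOf_dvd_of_pow_eq_one h3))

end ExampleGroup

/-! ### The diameter of the Engel graph of the affine semilinear examples -/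

section Diameter

variable {K L : Type*} [Field K] [Fintype K] [Field L] [Algebra K L] [FiniteDimensional K L]
  {e f : Lˣ} {t : ℕ}

theorem not_isFrobenius_and_diam_exampleGroup (hr : (Module.finrank K L).Prime) (ht : t.Prime)
    (hrt : Module.finrank K L ≠ t) (htq : ¬ t ∣ Fintype.card K - 1)
    (hε : orderOf (e ^ ∑ i ∈ Finset.range (Module.finrank K L), Fintype.card K ^ i) =
      Module.finrank K L) (hf : orderOf f = t) :
    ¬ IsFrobenius (ExampleGroup K L e f ⧸ hypercenter (ExampleGroup K L e f)) ∧
      diam (engelGraph (ExampleGroup K L e f)) = 4 := by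
  have hfin : Finite (ExampleGroup K L e f) := finite_exampleGroup
  have hsol : Group.IsSolvable (ExampleGroup K L e f) := isSolvable_exampleGroup
  have hPfin : Finite (Plane L) := Module.finite_of_finite K (M := Fin 2 → L)
  have hft : f ^ t = 1 := hf ▸ pow_orderOf_eq_one f
  have hwD : scalarFrob K e ∈ exampleD K L e f := Subgroup.subset_closure (Or.inl rfl)
  have hcD : diagAut (1, f) ∈ exampleD K L e f := Subgroup.subset_closure (Or.inr rfl)
  set φ := (exampleD K L e f).subtype with hφ
  let w : exampleD K L e f := ⟨scalarFrob K e, hwD⟩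
  let c : exampleD K L e f := ⟨diagAut (1, f), hcD⟩
  set ε := e ^ ∑ i ∈ Finset.range (Module.finrank K L), Fintype.card K ^ i with hεdef
  have hε1 : ε ≠ 1 := fun h => by
    rw [h, orderOf_one] at hε
    exact hr.one_lt.ne hε
  have hwr : scalarFrob K e ^ Module.finrank K L = diagAut (ε, ε) := scalarFrob_pow_finrank e
  -- `w ^ r` is a central element of `D` without fixed points
  have hs : ∀ v, φ (w ^ Module.finrank K L) v = v → v = 1 := by
    intro v hv
    refine eq_one_of_diagAut_apply_eq (p := (ε, ε)) hε1 hε1 ?_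
    rw [← hwr]
    exact hv
  have hsD : ∀ d, Commute (w ^ Module.finrank K L) d := by
    rintro ⟨d, hd⟩
    obtain ⟨i, j, rfl⟩ := exists_eq_of_mem_exampleD hd
    refine Subtype.ext ?_
    refine Commute.mul_right (a := scalarFrob K e ^ Module.finrank K L) ?_
      ((Commute.refl _).pow_pow _ _)
    change _ * _ = _ * _
    rw [hwr, ← map_mul, mul_comm, map_mul]
  have hw : ∀ v, φ w v = v → v = 1 := by
    intro v hv
    refine hs v ?_
    have : ∀ m : ℕ, φ (w ^ m) v = v := by
      intro m
      induction m with
      | zero => rfl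
      | succ m ih => rw [pow_succ, map_mul, MulAut.mul_apply, hv, ih]
    exact this _
  have hc1 : c ≠ 1 := by
    intro h
    have h1 : (1, f) = (1 : Lˣ × Lˣ) :=
      diagAut_injective ((congrArg Subtype.val h).trans (map_one diagAut).symm)
    have h2 : f = 1 := congrArg Prod.snd h1
    rw [h2, orderOf_one] at hf
    exact ht.one_lt.ne hf
  have hZ : hypercenter (ExampleGroup K L e f) = ⊥ :=
    hypercenter_eq_bot_of_center_eq_bot
      (center_semidirectProduct_eq_bot (exampleD K L e f).subtype_injective hs)
  let v₀ : Plane L := Multiplicative.ofAdd ![1, 0]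
  let v₁ : Plane L := Multiplicative.ofAdd ![0, 1]
  have hG : ¬ IsFrobenius (ExampleGroup K L e f ⧸ hypercenter (ExampleGroup K L e f)) := by
    intro h
    refine not_isFrobenius_semidirectProduct (φ := φ) (v₀ := v₀) hs hsD hc1 ?_ ?_ (h.of_mulEquiv
      ((QuotientGroup.quotientMulEquivOfEq hZ).trans QuotientGroup.quotientBot))
    · intro h
      have h1 : v₀.toAdd 0 = 0 := congrArg (fun v : Plane L => v.toAdd 0) h
      exact one_ne_zero h1
    · refine plane_ext ((diagAut_apply_zero (1, f) v₀).trans ?_)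
        ((diagAut_apply_one (1, f) v₀).trans ?_)
      · simp
      · simp [v₀]
  refine ⟨hG, le_antisymm (diam_le_of_hasWalk (engelGraph_hasWalk_four hG)) ?_⟩
  -- `Q` is the first coordinate axis, the set of fixed points of `c`
  let Q : Subgroup (Plane L) :=
    { carrier := {v | v.toAdd 1 = 0}
      one_mem' := rfl
      mul_mem' := fun {v w} hv hw => by
        change v.toAdd 1 + w.toAdd 1 = 0
        rw [show v.toAdd 1 = 0 from hv, show w.toAdd 1 = 0 from hw, add_zero]
      inv_mem' := fun {v} hv => neg_eq_zero.2 hv }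
  have hQ : ∀ (h : exampleD K L e f), ∀ v ∈ Q, φ h v ∈ Q := by
    rintro ⟨h, hh⟩ v hv
    obtain ⟨i, j, rfl⟩ := exists_eq_of_mem_exampleD hh
    change ((diagAut (1, f ^ i) * scalarFrob K e ^ j) v).toAdd 1 = 0
    rw [MulAut.mul_apply, scalarFrob_pow, MulAut.mul_apply, diagAut_apply_one, diagAut_apply_one,
      fieldAut_frobAut_pow_apply, show v.toAdd 1 = 0 from hv,
      zero_pow (pow_ne_zero _ Fintype.card_ne_zero), mul_zero, mul_zero]
  have hcases : ∀ d : exampleD K L e f, (∀ v, φ d v = v → v = 1) ∨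
      ∃ i : ℕ, (d : MulAut (Plane L)) = diagAut (1, f ^ i) := fun d =>
    fixedPoints_of_mem_exampleD hr ht hrt hε hft d.2
  let x : ExampleGroup K L e f := SemidirectProduct.inl v₁
  let y : ExampleGroup K L e f := SemidirectProduct.inr w
  have hv₁ : v₁ ∉ Q := fun h => one_ne_zero (α := L) h
  have hx : x ∉ hypercenter (ExampleGroup K L e f) := by
    rw [hZ, Subgroup.mem_bot]
    intro h
    have h1 : v₁ = 1 := congrArg SemidirectProduct.left h
    exact hv₁ (h1 ▸ Q.one_mem)
  have hy : y ∉ hypercenter (ExampleGroup K L e f) := by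
    rw [hZ, Subgroup.mem_bot]
    intro h
    have h1 : w = 1 := congrArg SemidirectProduct.right h
    exact hv₁ (hw v₁ (by rw [h1]; rfl) ▸ Q.one_mem)
  refine le_diam_of_not_hasWalk (n := 3) (x := ⟨x, hx⟩) (y := ⟨y, hy⟩)
    (fun a => (engelRel_iff_pos _ _).1 (EngelRel.of_commute (Commute.refl _)))
    (not_hasWalk_three_semidirectProduct hQ hw ?_ ?_ (by exact hv₁) rfl)
  · intro d hd hdw
    refine (hcases d).resolve_right ?_
    rintro ⟨i, hi⟩
    refine hd (Subtype.ext ?_)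
    have h1 : EngelRel (diagAut (1, f ^ i)) (scalarFrob K e) := by
      obtain ⟨n, hn⟩ := hdw
      rw [← hi]
      exact ⟨n, (map_engelWord φ d w n).symm.trans ((congrArg φ hn).trans (map_one φ))⟩
    rw [hi, eq_one_of_engelRel_scalarFrob ht htq
      (by rw [← pow_mul, mul_comm, pow_mul, hft, one_pow]) h1]
    exact map_one diagAut
  · intro d hd
    refine (hcases d).imp_right ?_
    rintro ⟨i, hi⟩ v hv
    have h1 : f ^ i ≠ 1 := fun h => hd (Subtype.ext (by
      rw [hi, h]
      exact map_one diagAut))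
    have h2 : (diagAut (1, f ^ i) v).toAdd 1 - v.toAdd 1 = 0 := by
      rw [← hi, sub_eq_add_neg]
      exact hv
    rw [diagAut_apply_one, ← sub_one_mul, mul_eq_zero, sub_eq_zero] at h2
    exact h2.resolve_left fun h => h1 (Units.ext h)

end Diameter

section Arithmetic

theorem nat_geom_sum_modEq_sq {q r : ℕ} (hodd : Odd r) (hq : q ≡ 1 [MOD r]) :
    ∑ i ∈ Finset.range r, q ^ i ≡ r [MOD r ^ 2] := by
  rw [← Int.natCast_modEq_iff]
  push_cast
  exact geom_sum_modEq_sq hodd ((Int.natCast_modEq_iff).2 hq)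

/-- The order `r` arises because the exponent is congruent to `r` modulo `r²`. -/
theorem orderOf_pow_geom_sum {G : Type*} [Group G] {e : G} {q r : ℕ} (hr : r.Prime) (hodd : Odd r)
    (hq : q ≡ 1 [MOD r]) (he : orderOf e = r ^ 2) :
    orderOf (e ^ ∑ i ∈ Finset.range r, q ^ i) = r := by
  rw [(pow_eq_pow_iff_modEq (x := e)).2 (he ▸ nat_geom_sum_modEq_sq hodd hq),
    orderOf_pow_of_dvd hr.ne_zero (he ▸ dvd_pow_self r two_ne_zero), he, sq,
    Nat.mul_div_cancel _ hr.pos]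

theorem exists_orderOf_eq_of_dvd {L : Type*} [Field L] [Finite L] {n : ℕ}
    (hn : n ∣ Nat.card L - 1) : ∃ u : Lˣ, orderOf u = n := by
  obtain ⟨g, hg⟩ := IsCyclic.exists_ofOrder_eq_natCard (α := Lˣ)
  have h1 : orderOf g = Nat.card L - 1 := by rw [hg, Nat.card_units]
  have h2 : orderOf g ≠ 0 := (orderOf_pos g).ne'
  obtain ⟨m, hm⟩ := hn
  rw [hm] at h1
  refine ⟨g ^ m, ?_⟩
  have hm0 : m ≠ 0 := fun h => h2 (by rw [h1, h, mul_zero])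
  rw [orderOf_pow_of_dvd hm0 (h1 ▸ Dvd.intro_left n rfl), h1,
    Nat.mul_div_cancel _ (Nat.pos_of_ne_zero hm0)]

end Arithmetic

theorem exampleGroup_properties {K L : Type*} [Field K] [Fintype K] [Field L] [Algebra K L]
    [FiniteDimensional K L] {q r t : ℕ} (hK : Fintype.card K = q) (hr : r.Prime) (hr3 : 3 ≤ r)
    (hrq : r ∣ q - 1) (hL : Module.finrank K L = r) (ht : t.Prime)
    (htN : t ∣ (q ^ r - 1) / (q - 1)) (htq : ¬ t ∣ q - 1) :
    (∃ e f : Lˣ, orderOf e = r ^ 2 ∧ orderOf f = t) ∧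
      ∀ e f : Lˣ, orderOf e = r ^ 2 → orderOf f = t →
        Finite (ExampleGroup K L e f) ∧ Group.IsSolvable (ExampleGroup K L e f) ∧
        ¬ IsFrobenius (ExampleGroup K L e f ⧸ hypercenter (ExampleGroup K L e f)) ∧
        diam (engelGraph (ExampleGroup K L e f)) = 4 := by
  have hfin : Finite L := Module.finite_of_finite K
  have hq1 : 1 < q := hK ▸ Fintype.one_lt_card
  have hodd : Odd r := hr.odd_of_ne_two (by omega)
  have hqr : q ≡ 1 [MOD r] := ((Nat.modEq_iff_dvd' hq1.le).2 hrq).symm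
  have hcard : Nat.card L = q ^ r := by
    rw [Module.natCard_eq_pow_finrank (K := K), Nat.card_eq_fintype_card, hK, hL]
  have hN : (q ^ r - 1) / (q - 1) = ∑ i ∈ Finset.range r, q ^ i := (Nat.geomSum_eq hq1 r).symm
  have hmul : (∑ i ∈ Finset.range r, q ^ i) * (q - 1) = q ^ r - 1 := by
    rw [← hN, Nat.div_mul_cancel]
    simpa using Nat.sub_dvd_pow_sub_pow q 1 r
  constructor
  · have hrN : r ∣ ∑ i ∈ Finset.range r, q ^ i :=
      Nat.modEq_zero_iff_dvd.1 (((nat_geom_sum_modEq_sq hodd hqr).of_dvd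
        (dvd_pow_self r two_ne_zero)).trans (Nat.modEq_zero_iff_dvd.2 dvd_rfl))
    obtain ⟨e, he⟩ := exists_orderOf_eq_of_dvd (L := L) (n := r ^ 2)
      (by rw [hcard, ← hmul, sq]; exact mul_dvd_mul hrN hrq)
    obtain ⟨f, hf⟩ := exists_orderOf_eq_of_dvd (L := L) (n := t)
      (by rw [hcard, ← hmul, ← hN]; exact htN.mul_right _)
    exact ⟨e, f, he, hf⟩
  · intro e f he hf
    subst hK hL
    exact ⟨finite_exampleGroup, isSolvable_exampleGroup,
      not_isFrobenius_and_diam_exampleGroup hr ht (fun h => htq (h ▸ hrq)) htq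
        (orderOf_pow_geom_sum hr hodd hqr he) hf⟩

/-- The smallest instance `q = 7`, `r = 3`, `t = 19`. -/
theorem exampleGroup_seven :
    ∃ e f : (GaloisField 7 3)ˣ, orderOf e = 3 ^ 2 ∧ orderOf f = 19 ∧
      Finite (ExampleGroup (ZMod 7) (GaloisField 7 3) e f) ∧
      Group.IsSolvable (ExampleGroup (ZMod 7) (GaloisField 7 3) e f) ∧
      ¬ IsFrobenius (ExampleGroup (ZMod 7) (GaloisField 7 3) e f ⧸
        hypercenter (ExampleGroup (ZMod 7) (GaloisField 7 3) e f)) ∧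
      diam (engelGraph (ExampleGroup (ZMod 7) (GaloisField 7 3) e f)) = 4 := by
  obtain ⟨⟨e, f, he, hf⟩, h⟩ := exampleGroup_properties (K := ZMod 7) (L := GaloisField 7 3)
    (q := 7) (r := 3) (t := 19) (ZMod.card 7) (by norm_num) le_rfl (by norm_num)
    (GaloisField.finrank 7 (by norm_num)) (by norm_num) (by norm_num) (by norm_num)
  exact ⟨e, f, he, hf, h e f he hf⟩

end Engel

theorem theorem1p3 :
    -- the upper bound, for all finite soluble groups
    (∀ (G : Type*) [Group G] [Finite G] [Group.IsSolvable G],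
      ¬ Engel.IsFrobenius (G ⧸ Engel.hypercenter G) →
        Engel.StronglyConnected (Engel.engelGraph G) ∧ Engel.diam (Engel.engelGraph G) ≤ 4) ∧
    -- the bound is attained
    (∃ (G : Type) (_ : Group G), Finite G ∧ Group.IsSolvable G ∧
      ¬ Engel.IsFrobenius (G ⧸ Engel.hypercenter G) ∧ Engel.diam (Engel.engelGraph G) = 4) ∧
    -- it is attained by the family of groups `F ⋊ ⟨zβ, c⟩`
    (∀ (K : Type*) (L : Type*) [Field K] [Fintype K] [Field L] [Algebra K L]
      [FiniteDimensional K L] (q r t : ℕ),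
      Fintype.card K = q → Odd q → r.Prime → 3 ≤ r → r ∣ q - 1 → ¬ r ^ 2 ∣ q - 1 →
      Module.finrank K L = r → t.Prime → t ∣ (q ^ r - 1) / (q - 1) → ¬ t ∣ q - 1 →
        (∃ e f : Lˣ, orderOf e = r ^ 2 ∧ orderOf f = t) ∧
        ∀ e f : Lˣ, orderOf e = r ^ 2 → orderOf f = t →
          Finite (Engel.ExampleGroup K L e f) ∧ Group.IsSolvable (Engel.ExampleGroup K L e f) ∧
          ¬ Engel.IsFrobenius
            (Engel.ExampleGroup K L e f ⧸ Engel.hypercenter (Engel.ExampleGroup K L e f)) ∧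
          Engel.diam (Engel.engelGraph (Engel.ExampleGroup K L e f)) = 4) ∧
    -- in particular for `q = 7`, `r = 3`, `t = 19`
    (∃ e f : (GaloisField 7 3)ˣ, orderOf e = 3 ^ 2 ∧ orderOf f = 19 ∧
      Finite (Engel.ExampleGroup (ZMod 7) (GaloisField 7 3) e f) ∧
      Group.IsSolvable (Engel.ExampleGroup (ZMod 7) (GaloisField 7 3) e f) ∧
      ¬ Engel.IsFrobenius (Engel.ExampleGroup (ZMod 7) (GaloisField 7 3) e f ⧸
        Engel.hypercenter (Engel.ExampleGroup (ZMod 7) (GaloisField 7 3) e f)) ∧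
      Engel.diam (Engel.engelGraph (Engel.ExampleGroup (ZMod 7) (GaloisField 7 3) e f)) = 4) := by
  refine ⟨fun G _ _ _ hG => ⟨fun x y => ⟨4, Engel.engelGraph_hasWalk_four hG x y⟩,
    Engel.diam_le_of_hasWalk (Engel.engelGraph_hasWalk_four hG)⟩, ?_, ?_,
    Engel.exampleGroup_seven⟩
  · obtain ⟨e, f, -, -, h⟩ := Engel.exampleGroup_seven
    exact ⟨_, inferInstance, h⟩
  · intro K L _ _ _ _ _ q r t hK _ hr hr3 hrq _ hL ht htN htq
    exact Engel.exampleGroup_properties hK hr hr3 hrq hL ht htN htq
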